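/- Let $n\ge 1$ and $k>1$ be integers, and write $\mathbb{R}_+^n=\{x\in\mathbb{R}^n : x_i>0 \text{ for all } i\}$. A function $g$ on $\mathbb{R}^n$ is called unconditional if $g(x_1,\dots,x_n)=g(|x_1|,\dots,|x_n|)$ for all $x\in\mathbb{R}^n$. Let $\mu$ be a probability measure on $\mathbb{R}^n$ with density $\exp(-\varphi)$ with respect to Lebesgue measure, where $\varphi:\mathbb{R}^n\to(-\infty,\infty]$ satisfies: - $\varphi$ is unconditional; - $\varphi|_{\mathbb{R}_+^n}$ is increasing, that is, $\varphi(x)\le\varphi(y)$ whenever $x,y\in\mathbb{R}_+^n$ and $x_i\le y_i$ for all $i$; - $\varphi|_{\mathbb{R}_+^n}$ is $(1/k)$-convex, that is, the function $(x_1,\dots,x_n)\mapsto\varphi(x_1^k,\dots,x_n^k)$ is convex on $\mathbb{R}_+^n$. Denote $V_i=\int_{\mathbb{R}^n}x_i^2\,d\mu(x)$ for $i=1,\dots,n$. Let $f:\mathbb{R}^n\to\mathbb{R}$ be a $\mu$-integrable, locally Lipschitz function with $\int_{\mathbb{R}^n} f\,d\mu=0$. Then $$\int_{\mathbb{R}^n}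 f^2\,d\mu\le\int_{\mathbb{R}^n}\sum_{i=1}^n\left(\frac{k^2}{k-1}x_i^2+V_i\right)\left|\partial_i f(x)\right|^2d\mu(x),$$ where $\partial_i f=\partial f/\partial x_i$, which exists almost everywhere. If moreover $f$ is unconditional, then $$\int_{\mathbb{R}^n} f^2\,d\mu\le\frac{k^2}{k-1}\int_{\mathbb{R}^n}\sum_{i=1}^n x_i^2\left|\partial_i f(x)\right|^2d\mu(x).$$ (All these integrals of nonnegative functions are taken in $[0,\infty]$.) -/

import Mathlib

open MeasureTheory
open scoped ENNReal

/-- The orthant `ℝ₊ⁿ` of all points with (strictly) positive coordinates. -/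
def posOrthant (n : ℕ) : Set (Fin n → ℝ) := {x | ∀ i, 0 < x i}

/-- A function on `ℝⁿ` is unconditional if `g (x₁, …, xₙ) = g (|x₁|, …, |xₙ|)` for all `x`. -/
def Unconditional {n : ℕ} {β : Type*} (g : (Fin n → ℝ) → β) : Prop :=
  ∀ x, g x = g (fun i => |x i|)

/-- Convexity, on a set `s`, of a function with values in `(-∞, ∞]`.  (The value `-∞` is to be
excluded separately, so that no expression `∞ - ∞` occurs on the right; `0 * ∞ = 0`.) -/
def ExtConvexOn {n : ℕ} (s : Set (Fin n → ℝ)) (g : (Fin n → ℝ) → EReal) : Prop :=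
  Convex ℝ s ∧ ∀ x ∈ s, ∀ y ∈ s, ∀ a b : ℝ, 0 ≤ a → 0 ≤ b → a + b = 1 →
    g (a • x + b • y) ≤ (a : EReal) * g x + (b : EReal) * g y

/-- The restriction of `φ` to the orthant is `p`-convex: the function
`(x₁, …, xₙ) ↦ φ (x₁ ^ (1/p), …, xₙ ^ (1/p))` is convex on the orthant. -/
def FracConvexOnOrthant {n : ℕ} (p : ℝ) (φ : (Fin n → ℝ) → EReal) : Prop :=
  ExtConvexOn (posOrthant n) (fun x => φ (fun i => x i ^ (1 / p)))

/-- The partial derivative `∂ᵢ f (x)`, i.e. the derivative of `t ↦ f (x + t eᵢ)` at `t = 0`. -/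
noncomputable def partialDeriv {n : ℕ} (i : Fin n) (f : (Fin n → ℝ) → ℝ) (x : Fin n → ℝ) : ℝ :=
  lineDeriv ℝ f x (Pi.single i 1)

/-- `Vᵢ = ∫ xᵢ² dμ`, as an integral of a nonnegative function, with values in `[0, ∞]`. -/
noncomputable def secondMoment {n : ℕ} (μ : Measure (Fin n → ℝ)) (i : Fin n) : ℝ≥0∞ :=
  ∫⁻ x, ENNReal.ofReal (x i ^ 2) ∂μ

/-!
The Prékopa–Leindler inequality, applied to the tilts of a density by `2 ε g`, `0` and the
Hopf–Lax sup-convolution of `ε g`, gives the Brascamp–Lieb inequality `Var g ≤ ∫ ∑ aᵢ² |∂ᵢ g|²`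
as `ε → 0`, where `diag aᵢ⁻²` bounds the Hessian of the potential from below. Log-concavity enters
only at midpoints, so the potential need not be differentiable.

On the orthant, substitute `xᵢ = yᵢᵖ`. The transported potential is convex up to the logarithm of
the Jacobian `∏ p yᵢᵖ⁻¹`, whose Hessian contributes `(p - 1) / yᵢ²`; since
`yᵢ ∂f/∂yᵢ = p xᵢ ∂f/∂xᵢ`, the Brascamp–Lieb inequality becomes a weighted Poincaré inequality with
weights `p² / (p - 1) xᵢ²`, on each of the `2ⁿ` orthants.

It remains to bound the variance of the orthant means of `f`, which vanish for unconditional `f`.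
The Poincaré inequality on the discrete cube reduces this to pairs of neighbouring orthants, where
the difference of the means is an integral over the common face: because the density decreases
away from the face, a Hardy-type inequality bounds it by `Vᵢ ∫ |∂ᵢ f|²`.
-/

open Filter Topology

/-! ### The Prékopa–Leindler inequality at midpoints -/

theorem volume_add_le_of_isCompact {K L C : Set ℝ} (hK : IsCompact K) (hL : IsCompact L)
    (hK0 : K.Nonempty) (hL0 : L.Nonempty) (h : ∀ z t, z + t ∈ K → z - t ∈ L → z ∈ C) :
    volume K + volume L ≤ 2 * volume C := by
  obtain ⟨M, hMK, hM⟩ := hK.exists_isGreatest hK0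
  obtain ⟨l, hlL, hl⟩ := hL.exists_isLeast hL0
  set D : Set ℝ := (fun x => (2⁻¹ : ℝ) * x) ⁻¹' C with hD
  have volume_D : volume D = 2 * volume C := by
    rw [hD, Real.volume_preimage_mul_left (by norm_num)]
    simp
  have add_mem_D : ∀ x ∈ K, ∀ y ∈ L, x + y ∈ D := fun x hx y hy =>
    h _ (2⁻¹ * (x - y)) (by ring_nf; exact hx) (by ring_nf; exact hy)
  -- The translates `K + l` and `M + L` lie in `K + L` and overlap in the single point `M + l`.
  have K_le : volume K ≤ volume (D ∩ Set.Iic (M + l)) := by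
    rw [← measure_preimage_add volume (-l) K]
    refine measure_mono fun x hx => ⟨?_, ?_⟩
    · simpa using add_mem_D _ hx l hlL
    · simpa [add_comm M] using hM hx
  have L_le : volume L ≤ volume (D \ Set.Iic (M + l)) := by
    rw [← measure_preimage_add volume (-M) L, ← measure_sdiff_null (measure_singleton (M + l))]
    refine measure_mono fun x ⟨hx, hne⟩ => ⟨?_, ?_⟩
    · simpa using add_mem_D M hMK _ hx
    · have := hl hx
      exact not_le.2 (lt_of_le_of_ne (by linarith) (Ne.symm hne))
  calc volume K + volume L ≤ volume (D ∩ Set.Iic (M + l)) + volume (D \ Set.Iic (M + l)) :=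
        add_le_add K_le L_le
    _ = 2 * volume C := by rw [measure_inter_add_sdiff D measurableSet_Iic, volume_D]

theorem volume_add_le {A B C : Set ℝ} (hA : MeasurableSet A) (hB : MeasurableSet B)
    (hA0 : A.Nonempty) (hB0 : B.Nonempty) (h : ∀ z t, z + t ∈ A → z - t ∈ B → z ∈ C) :
    volume A + volume B ≤ 2 * volume C := by
  obtain ⟨a, ha⟩ := hA0
  obtain ⟨b, hb⟩ := hB0
  rw [hA.measure_eq_iSup_isCompact, hB.measure_eq_iSup_isCompact]
  simp only [iSup_and']
  refine ENNReal.biSup_add_biSup_le' ⟨∅, by simp⟩ ⟨∅, by simp⟩ ?_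
  rintro K ⟨hKA, hK⟩ L ⟨hLB, hL⟩
  calc volume K + volume L ≤ volume (insert a K) + volume (insert b L) := by
        gcongr <;> exact Set.subset_insert _ _
    _ ≤ 2 * volume C :=
        volume_add_le_of_isCompact (hK.insert a) (hL.insert b) ⟨a, by simp⟩ ⟨b, by simp⟩
          fun z t hx hy => h z t (Set.insert_subset ha hKA hx) (Set.insert_subset hb hLB hy)

theorem lintegral_eq_lintegral_volume_ofReal_lt {u : ℝ → ℝ≥0∞} (hu : Measurable u)
    (hfin : ∀ x, u x ≠ ∞) :
    ∫⁻ x, u x = ∫⁻ t in Set.Ioi (0 : ℝ), volume {x | ENNReal.ofReal t < u x} := by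
  have layer_cake := lintegral_eq_lintegral_meas_lt volume
    (ae_of_all _ fun x => (u x).toReal_nonneg) hu.ennreal_toReal.aemeasurable
  simp only [ENNReal.ofReal_toReal (hfin _)] at layer_cake
  rw [layer_cake]
  refine setLIntegral_congr_fun measurableSet_Ioi fun t (ht : 0 < t) => ?_
  simp only [← ENNReal.ofReal_lt_iff_lt_toReal ht.le (hfin _)]

theorem lintegral_add_le_of_iSup_eq_one {u v m : ℝ → ℝ≥0∞} (hu : Measurable u)
    (hv : Measurable v) (hm : Measurable m) (hu1 : ⨆ x, u x = 1) (hv1 : ⨆ x, v x = 1)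
    (h : ∀ z t, u (z + t) * v (z - t) ≤ m z ^ 2) :
    (∫⁻ x, u x) + ∫⁻ x, v x ≤ 2 * ∫⁻ x, m x := by
  have u_le : ∀ x, u x ≤ 1 := fun x => hu1 ▸ le_iSup u x
  have v_le : ∀ x, v x ≤ 1 := fun x => hv1 ▸ le_iSup v x
  have hm' : Measurable fun x => min (m x) 1 := hm.min measurable_const
  have level_measurable : ∀ w : ℝ → ℝ≥0∞,
      Measurable fun t : ℝ => volume {x | ENNReal.ofReal t < w x} := fun w =>
    Antitone.measurable fun s t hst => measure_mono fun x hx =>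
      (ENNReal.ofReal_le_ofReal hst).trans_lt hx
  have level_le : ∀ t ∈ Set.Ioi (0 : ℝ),
      volume {x | ENNReal.ofReal t < u x} + volume {x | ENNReal.ofReal t < v x} ≤
        2 * volume {x | ENNReal.ofReal t < min (m x) 1} := fun t _ => by
    rcases lt_or_ge (ENNReal.ofReal t) 1 with ht | ht
    · refine volume_add_le (measurableSet_lt measurable_const hu)
        (measurableSet_lt measurable_const hv) (lt_iSup_iff.1 (ht.trans_eq hu1.symm))
        (lt_iSup_iff.1 (ht.trans_eq hv1.symm)) fun z s hx hy => lt_min ?_ ht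
      refine lt_of_pow_lt_pow_left' 2 (lt_of_lt_of_le ?_ (h z s))
      rw [sq]
      exact ENNReal.mul_lt_mul hx hy
    · have empty : ∀ w : ℝ → ℝ≥0∞, (∀ x, w x ≤ 1) → {x | ENNReal.ofReal t < w x} = ∅ :=
        fun w hw => Set.eq_empty_of_forall_notMem fun x hx => (hx.trans_le (hw x)).not_ge ht
      simp [empty u u_le, empty v v_le]
  calc (∫⁻ x, u x) + ∫⁻ x, v x
      = ∫⁻ t in Set.Ioi (0 : ℝ),
          (volume {x | ENNReal.ofReal t < u x} + volume {x | ENNReal.ofReal t < v x}) := by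
        rw [lintegral_add_left (level_measurable u), lintegral_eq_lintegral_volume_ofReal_lt hu
          fun x => ((u_le x).trans_lt ENNReal.one_lt_top).ne,
          lintegral_eq_lintegral_volume_ofReal_lt hv
          fun x => ((v_le x).trans_lt ENNReal.one_lt_top).ne]
    _ ≤ ∫⁻ t in Set.Ioi (0 : ℝ), 2 * volume {x | ENNReal.ofReal t < min (m x) 1} :=
        setLIntegral_mono ((level_measurable _).const_mul 2) level_le
    _ = 2 * ∫⁻ x, min (m x) 1 := by
        rw [lintegral_const_mul 2 (level_measurable _),
          lintegral_eq_lintegral_volume_ofReal_lt hm'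
          fun x => ((min_le_right _ _).trans_lt ENNReal.one_lt_top).ne]
    _ ≤ 2 * ∫⁻ x, m x := by
        gcongr
        exact min_le_left _ _

theorem ennreal_mul_le_sq_of_add_le {a b c : ℝ≥0∞} (h : a + b ≤ 2 * c) : a * b ≤ c ^ 2 := by
  rcases eq_or_ne c ∞ with rfl | hc
  · simp
  have hab : a + b ≠ ∞ := ne_top_of_le_ne_top (ENNReal.mul_ne_top (by simp) hc) h
  lift a to NNReal using (ENNReal.add_ne_top.1 hab).1
  lift b to NNReal using (ENNReal.add_ne_top.1 hab).2
  lift c to NNReal using hc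
  norm_cast at h ⊢
  rw [← NNReal.coe_le_coe] at h ⊢
  push_cast at h ⊢
  nlinarith [sq_nonneg ((a : ℝ) - b), mul_self_le_mul_self (add_nonneg a.2 b.2) h]

theorem lintegral_mul_le_sq_of_iSup_ne_top {u v m : ℝ → ℝ≥0∞} (hu : Measurable u)
    (hv : Measurable v) (hm : Measurable m) (hu_top : ⨆ x, u x ≠ ∞) (hv_top : ⨆ x, v x ≠ ∞)
    (h : ∀ z t, u (z + t) * v (z - t) ≤ m z ^ 2) :
    (∫⁻ x, u x) * ∫⁻ x, v x ≤ (∫⁻ x, m x) ^ 2 := by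
  set a := ⨆ x, u x with ha
  set b := ⨆ x, v x with hb
  rcases eq_or_ne a 0 with ha0 | ha0
  · have hu0 : ∀ x, u x = 0 := by simpa using ha.symm.trans ha0
    simp [hu0]
  rcases eq_or_ne b 0 with hb0 | hb0
  · have hv0 : ∀ x, v x = 0 := by simpa using hb.symm.trans hb0
    simp [hv0]
  obtain ⟨s, hs⟩ : ∃ s : ℝ≥0∞, s ^ 2 = a⁻¹ * b⁻¹ :=
    ⟨(a⁻¹ * b⁻¹) ^ (1 / 2 : ℝ), by rw [← ENNReal.rpow_natCast, ← ENNReal.rpow_mul]; norm_num⟩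
  have normalised : (a⁻¹ * ∫⁻ x, u x) * (b⁻¹ * ∫⁻ x, v x) ≤ (s * ∫⁻ x, m x) ^ 2 := by
    rw [← lintegral_const_mul _ hu, ← lintegral_const_mul _ hv, ← lintegral_const_mul _ hm]
    refine ennreal_mul_le_sq_of_add_le <| lintegral_add_le_of_iSup_eq_one (hu.const_mul _)
      (hv.const_mul _) (hm.const_mul _) ?_ ?_ fun z t => ?_
    · rw [← ENNReal.mul_iSup, ← ha, ENNReal.inv_mul_cancel ha0 hu_top]
    · rw [← ENNReal.mul_iSup, ← hb, ENNReal.inv_mul_cancel hb0 hv_top]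
    · rw [mul_pow, hs, mul_mul_mul_comm]
      gcongr
      exact h z t
  have hs0 : a⁻¹ * b⁻¹ ≠ 0 := by simp [hu_top, hv_top]
  have hs_top : a⁻¹ * b⁻¹ ≠ ∞ := ENNReal.mul_ne_top (by simpa) (by simpa)
  rwa [mul_pow, hs, mul_mul_mul_comm, ENNReal.mul_le_mul_iff_right hs0 hs_top] at normalised

theorem lintegral_eq_iSup_lintegral_min_natCast {u : ℝ → ℝ≥0∞} (hu : Measurable u) :
    ∫⁻ x, u x = ⨆ N : ℕ, ∫⁻ x, min (u x) N := by
  rw [← lintegral_iSup (fun N => hu.min measurable_const)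
    (fun N M hNM x => min_le_min le_rfl (by exact_mod_cast hNM))]
  simp only [← inf_iSup_eq, ENNReal.iSup_natCast, inf_top_eq]

/-- A measure on an additive group satisfies the Prékopa–Leindler inequality at midpoints.  The
two points and their midpoint are written as `z + h`, `z - h` and `z`. -/
def MidpointPrekopaLeindler {E : Type*} [AddGroup E] [MeasurableSpace E] (μ : Measure E) : Prop :=
  ∀ ⦃u v m : E → ℝ≥0∞⦄, Measurable u → Measurable v → Measurable m →
    (∀ z h, u (z + h) * v (z - h) ≤ m z ^ 2) →
      (∫⁻ x, u x ∂μ) * ∫⁻ x, v x ∂μ ≤ (∫⁻ x, m x ∂μ) ^ 2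

namespace MidpointPrekopaLeindler

theorem volume_real : MidpointPrekopaLeindler (volume : Measure ℝ) := fun u v m hu hv hm h => by
  rw [lintegral_eq_iSup_lintegral_min_natCast hu, lintegral_eq_iSup_lintegral_min_natCast hv]
  simp only [ENNReal.iSup_mul, ENNReal.mul_iSup]
  refine iSup_le fun M => iSup_le fun N => ?_
  have bounded : ∀ (w : ℝ → ℝ≥0∞) (N : ℕ), ⨆ x, min (w x) (N : ℝ≥0∞) ≠ ∞ := fun w N =>
    ne_top_of_le_ne_top (ENNReal.natCast_ne_top N) (iSup_le fun x => min_le_right _ _)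
  exact lintegral_mul_le_sq_of_iSup_ne_top (hu.min measurable_const) (hv.min measurable_const) hm
    (bounded u N) (bounded v M) fun z t =>
      (mul_le_mul' (min_le_left _ _) (min_le_left _ _)).trans (h z t)

variable {E F : Type*} [AddGroup E] [MeasurableSpace E] [AddGroup F] [MeasurableSpace F]
  {μ : Measure E} {ν : Measure F}

theorem prod [SFinite ν] (hμ : MidpointPrekopaLeindler μ) (hν : MidpointPrekopaLeindler ν) :
    MidpointPrekopaLeindler (μ.prod ν) := fun u v m hu hv hm h => by
  rw [lintegral_prod _ hu.aemeasurable, lintegral_prod _ hv.aemeasurable,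
    lintegral_prod _ hm.aemeasurable]
  exact hμ hu.lintegral_prod_right' hv.lintegral_prod_right' hm.lintegral_prod_right' fun z s =>
    hν (hu.comp measurable_prodMk_left) (hv.comp measurable_prodMk_left)
      (hm.comp measurable_prodMk_left) fun w t => h (z, w) (s, t)

theorem of_measurePreserving (hμ : MidpointPrekopaLeindler μ) (e : E →+ F)
    (he : MeasurePreserving e μ ν) : MidpointPrekopaLeindler ν := fun u v m hu hv hm h => by
  rw [← he.lintegral_comp hu, ← he.lintegral_comp hv, ← he.lintegral_comp hm]
  exact hμ (hu.comp he.measurable) (hv.comp he.measurable) (hm.comp he.measurable) fun z t => by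
    simpa only [Function.comp_apply, map_add, map_sub] using h (e z) (e t)

theorem volume_pi : ∀ n : ℕ, MidpointPrekopaLeindler (volume : Measure (Fin n → ℝ))
  | 0 => fun _ _ _ _ _ _ h => by
    rw [MeasureTheory.volume_pi, Measure.pi_of_empty _ 0]
    simpa [lintegral_dirac] using h 0 0
  | n + 1 =>
    let insertZero : ℝ × (Fin n → ℝ) →+ (Fin (n + 1) → ℝ) :=
      { toFun := fun p => Fin.insertNth 0 p.1 p.2
        map_zero' := by simp
        map_add' := fun p q => Fin.insertNth_add (α := fun _ => ℝ) 0 p.1 q.1 p.2 q.2 }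
    (volume_real.prod (volume_pi n)).of_measurePreserving insertZero
      (volume_preserving_piFinSuccAbove (fun _ : Fin (n + 1) => ℝ) 0).symm

theorem of_aemeasurable (hμ : MidpointPrekopaLeindler μ) {u v m : E → ℝ≥0∞}
    (hm : AEMeasurable m μ) (h : ∀ z t, u (z + t) * v (z - t) ≤ m z ^ 2) :
    (∫⁻ x, u x ∂μ) * ∫⁻ x, v x ∂μ ≤ (∫⁻ x, m x ∂μ) ^ 2 := by
  obtain ⟨u', hu', hu_le, hu_eq⟩ := exists_measurable_le_lintegral_eq μ u
  obtain ⟨v', hv', hv_le, hv_eq⟩ := exists_measurable_le_lintegral_eq μ v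
  obtain ⟨s, hs_sub, hs, hs0⟩ := exists_measurable_superset_of_null (ae_iff.1 hm.ae_eq_mk)
  classical
  set m' := s.piecewise (fun _ => ∞) (hm.mk m) with hm'_def
  have m_le : ∀ x, m x ≤ m' x := fun x => by
    by_cases hx : x ∈ s
    · simp [m', hx]
    · rw [hm'_def, Set.piecewise_eq_of_notMem _ _ _ hx]
      exact (not_not.1 fun hne => hx (hs_sub hne)).le
  have hm_eq : ∫⁻ x, m x ∂μ = ∫⁻ x, m' x ∂μ := lintegral_congr_ae <| by
    filter_upwards [measure_eq_zero_iff_ae_notMem.1 hs0, hm.ae_eq_mk] with x hx hmk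
    rw [hm'_def, Set.piecewise_eq_of_notMem _ _ _ hx, hmk]
  rw [hu_eq, hv_eq, hm_eq]
  exact hμ hu' hv' (measurable_const.piecewise hs hm.measurable_mk) fun z t =>
    calc u' (z + t) * v' (z - t) ≤ u (z + t) * v (z - t) := mul_le_mul' (hu_le _) (hv_le _)
      _ ≤ m z ^ 2 := h z t
      _ ≤ m' z ^ 2 := by gcongr; exact m_le z

end MidpointPrekopaLeindler

/-! ### Second-order expansion of exponential integrals -/

theorem abs_exp_sub_taylor_two_le {s : ℝ} (hs : |s| ≤ 1) :
    |Real.exp s - (1 + s + s ^ 2 / 2)| ≤ |s| ^ 3 := by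
  have := Real.exp_bound hs (n := 3) (by norm_num)
  norm_num [Finset.sum_range_succ, Nat.factorial] at this
  exact this.trans (mul_le_of_le_one_right (by positivity) (by norm_num))

theorem abs_exp_quotient_sub_le {ε y d B : ℝ} (hε : 0 < ε) (hB : |y + ε * d| ≤ B)
    (hεB : ε * B ≤ 1) :
    |(Real.exp (ε * y + ε ^ 2 * d) - 1 - ε * y) / ε ^ 2 - (d + (y + ε * d) ^ 2 / 2)| ≤
      ε * B ^ 3 := by
  set r := y + ε * d with hr
  have abs_εr : |ε * r| = ε * |r| := by rw [abs_mul, abs_of_pos hε]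
  have taylor : |Real.exp (ε * r) - (1 + ε * r + (ε * r) ^ 2 / 2)| ≤ |ε * r| ^ 3 :=
    abs_exp_sub_taylor_two_le (by rw [abs_εr]; exact le_trans (by gcongr) hεB)
  calc _ = |Real.exp (ε * r) - (1 + ε * r + (ε * r) ^ 2 / 2)| / ε ^ 2 := by
        rw [← abs_of_pos (pow_pos hε 2), ← abs_div, abs_of_pos (pow_pos hε 2), hr]
        congr 1
        field_simp
        ring_nf
    _ ≤ |ε * r| ^ 3 / ε ^ 2 := by gcongr
    _ = ε * |r| ^ 3 := by rw [abs_εr]; field_simp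
    _ ≤ ε * B ^ 3 := by gcongr

theorem abs_exp_quotient_le {ε y d B C : ℝ} (hε : 0 < ε) (hB : |y + ε * d| ≤ B) (hd : |d| ≤ C)
    (hεB : ε * B ≤ 1) :
    |(Real.exp (ε * y + ε ^ 2 * d) - 1 - ε * y) / ε ^ 2| ≤ B ^ 2 + (C + B ^ 2 / 2) := by
  have : 0 ≤ B := (abs_nonneg _).trans hB
  have main_term : |d + (y + ε * d) ^ 2 / 2| ≤ C + B ^ 2 / 2 := by
    refine (abs_add_le _ _).trans (add_le_add hd ?_)
    rw [abs_of_nonneg (by positivity), ← sq_abs]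
    gcongr
  have remainder : ε * B ^ 3 ≤ B ^ 2 := by
    calc ε * B ^ 3 = ε * B * B ^ 2 := by ring
      _ ≤ B ^ 2 := mul_le_of_le_one_left (by positivity) hεB
  calc _ ≤ _ + |d + (y + ε * d) ^ 2 / 2| := abs_sub_abs_le_abs_sub _ _ |> sub_le_iff_le_add.1
    _ ≤ B ^ 2 + (C + B ^ 2 / 2) :=
      add_le_add ((abs_exp_quotient_sub_le hε hB hεB).trans remainder) main_term

theorem tendsto_exp_quotient {y γ : ℝ} {δ : ℝ → ℝ} (hδ : Tendsto δ (𝓝[>] 0) (𝓝 γ)) :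
    Tendsto (fun ε => (Real.exp (ε * y + ε ^ 2 * δ ε) - 1 - ε * y) / ε ^ 2) (𝓝[>] 0)
      (𝓝 (γ + y ^ 2 / 2)) := by
  have hε : Tendsto (fun ε : ℝ => ε) (𝓝[>] 0) (𝓝 0) :=
    tendsto_nhdsWithin_of_tendsto_nhds tendsto_id
  have hr : Tendsto (fun ε => y + ε * δ ε) (𝓝[>] 0) (𝓝 y) := by
    simpa using tendsto_const_nhds.add (hε.mul hδ)
  have remainder : Tendsto (fun ε : ℝ => ε * (|y| + 1) ^ 3) (𝓝[>] 0) (𝓝 0) := by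
    simpa using hε.mul_const ((|y| + 1) ^ 3)
  refine ((hδ.add ((hr.pow 2).div_const 2))).congr_dist (squeeze_zero' ?_ ?_ remainder)
  · exact Eventually.of_forall fun _ => dist_nonneg
  · filter_upwards [self_mem_nhdsWithin, hr.abs.eventually_le_const (lt_add_one |y|),
      (hε.mul_const (|y| + 1)).eventually_le_const (by simp : 0 * (|y| + 1) < 1)]
      with ε hε0 hεr hε1
    rw [dist_comm, Real.dist_eq]
    exact abs_exp_quotient_sub_le hε0 hεr hε1

theorem eventually_abs_add_mul_le {X : Type*} [MeasurableSpace X] {ν : Measure X} {g : X → ℝ}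
    {D : ℝ → X → ℝ} {N C : ℝ} (hgN : ∀ᵐ x ∂ν, |g x| ≤ N) (hDC : ∀ᵐ x ∂ν, ∀ ε > 0, |D ε x| ≤ C) :
    ∀ᶠ ε : ℝ in 𝓝[>] 0, 0 < ε ∧ ε * (N + C) ≤ 1 ∧
      ∀ᵐ x ∂ν, |D ε x| ≤ C ∧ |g x + ε * D ε x| ≤ N + C := by
  have hε : Tendsto (fun ε : ℝ => ε) (𝓝[>] 0) (𝓝 0) :=
    tendsto_nhdsWithin_of_tendsto_nhds tendsto_id
  filter_upwards [self_mem_nhdsWithin, hε.eventually_le_const one_pos,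
    (hε.mul_const (N + C)).eventually_le_const (by simp : 0 * (N + C) < 1)]
    with ε (hε0 : 0 < ε) hε1 hεNC
  refine ⟨hε0, hεNC, ?_⟩
  filter_upwards [hgN, hDC] with x hx hDx
  refine ⟨hDx ε hε0, (abs_add_le _ _).trans (add_le_add hx ?_)⟩
  rw [abs_mul, abs_of_pos hε0]
  exact (mul_le_of_le_one_left (abs_nonneg _) hε1).trans (hDx ε hε0)

theorem tendsto_integral_exp_quotient {X : Type*} [MeasurableSpace X] {ν : Measure X}
    [IsFiniteMeasure ν] {g G : X → ℝ} {D : ℝ → X → ℝ} {N C : ℝ} (hg : AEMeasurable g ν)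
    (hD : ∀ ε > 0, AEMeasurable (D ε) ν) (hgN : ∀ᵐ x ∂ν, |g x| ≤ N)
    (hDC : ∀ᵐ x ∂ν, ∀ ε > 0, |D ε x| ≤ C)
    (hDG : ∀ᵐ x ∂ν, Tendsto (fun ε => D ε x) (𝓝[>] 0) (𝓝 (G x))) :
    Tendsto (fun ε => (∫ x, Real.exp (ε * g x + ε ^ 2 * D ε x) ∂ν - ν.real Set.univ -
      ε * ∫ x, g x ∂ν) / ε ^ 2) (𝓝[>] 0) (𝓝 (∫ x, (G x + g x ^ 2 / 2) ∂ν)) := by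
  have small := eventually_abs_add_mul_le hgN hDC
  have exp_measurable : ∀ ε > 0, AEStronglyMeasurable
      (fun x => Real.exp (ε * g x + ε ^ 2 * D ε x)) ν := fun ε hε =>
    (Real.measurable_exp.comp_aemeasurable
      ((hg.const_mul ε).add ((hD ε hε).const_mul _))).aestronglyMeasurable
  have dominated := tendsto_integral_filter_of_dominated_convergence (l := 𝓝[>] 0)
    (F := fun ε x => (Real.exp (ε * g x + ε ^ 2 * D ε x) - 1 - ε * g x) / ε ^ 2)
    (fun _ => (N + C) ^ 2 + (C + (N + C) ^ 2 / 2))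
    (eventually_mem_nhdsWithin.mono fun ε hε =>
      (((exp_measurable ε hε).sub aestronglyMeasurable_const).sub
        (hg.const_mul ε).aestronglyMeasurable).mul_const _)
    (small.mono fun ε ⟨hε, hεNC, hr⟩ =>
      hr.mono fun x hx => abs_exp_quotient_le hε hx.2 hx.1 hεNC)
    (integrable_const _) (hDG.mono fun x hx => tendsto_exp_quotient hx)
  refine dominated.congr' ?_
  filter_upwards [small] with ε ⟨hε, hεNC, hr⟩
  have exp_integrable : Integrable (fun x => Real.exp (ε * g x + ε ^ 2 * D ε x)) ν :=
    Integrable.of_bound (exp_measurable ε hε) (Real.exp 1) <| hr.mono fun x hx => by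
      rw [Real.norm_eq_abs, Real.abs_exp, Real.exp_le_exp]
      calc ε * g x + ε ^ 2 * D ε x = ε * (g x + ε * D ε x) := by ring
        _ ≤ ε * (N + C) := mul_le_mul_of_nonneg_left ((le_abs_self _).trans hx.2) hε.le
        _ ≤ 1 := hεNC
  have g_integrable : Integrable g ν := .of_bound hg.aestronglyMeasurable N hgN
  rw [integral_div, integral_sub (f := fun x => Real.exp (ε * g x + ε ^ 2 * D ε x) - 1)
      (exp_integrable.sub (integrable_const 1)) (g_integrable.const_mul ε),
    integral_sub exp_integrable (integrable_const 1), integral_const, integral_const_mul,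
    smul_eq_mul, mul_one]

theorem integral_sq_le_of_integral_exp_mul_le_sq {X : Type*} [MeasurableSpace X] {ν : Measure X}
    [IsFiniteMeasure ν] {g G : X → ℝ} {D : ℝ → X → ℝ} {N C : ℝ} (hg : AEMeasurable g ν)
    (hD : ∀ ε > 0, AEMeasurable (D ε) ν) (hgN : ∀ᵐ x ∂ν, |g x| ≤ N)
    (hDC : ∀ᵐ x ∂ν, ∀ ε > 0, |D ε x| ≤ C)
    (hDG : ∀ᵐ x ∂ν, Tendsto (fun ε => D ε x) (𝓝[>] 0) (𝓝 (G x))) (hG : AEMeasurable G ν)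
    (h : ∀ ε > 0, ν.real Set.univ * ∫ x, Real.exp (ε * (2 * g x)) ∂ν ≤
      (∫ x, Real.exp (ε * g x + ε ^ 2 * D ε x) ∂ν) ^ 2) :
    ν.real Set.univ * ∫ x, g x ^ 2 ∂ν ≤
      (∫ x, g x ∂ν) ^ 2 + ν.real Set.univ * (2 * ∫ x, G x ∂ν) := by
  set c := ν.real Set.univ with hc
  set a := ∫ x, g x ∂ν with ha
  have g_sq_integrable : Integrable (fun x => g x ^ 2) ν :=
    .of_bound (hg.pow_const 2).aestronglyMeasurable (N ^ 2) <| hgN.mono fun x hx => by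
      rw [norm_pow, Real.norm_eq_abs]
      gcongr
  have G_integrable : Integrable G ν :=
    .of_bound hG.aestronglyMeasurable C <| by
      filter_upwards [hDC, hDG] with x hDx hx
      exact le_of_tendsto hx.abs (eventually_mem_nhdsWithin.mono hDx)
  have lower := tendsto_integral_exp_quotient (g := fun x => 2 * g x) (D := fun _ _ => 0)
    (G := fun _ => 0) (N := 2 * N) (C := 0) (hg.const_mul 2) (fun _ _ => aemeasurable_const)
    (hgN.mono fun x hx => by rw [abs_mul, abs_two]; gcongr) (by simp)
    (ae_of_all _ fun _ => tendsto_const_nhds)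
  have upper := tendsto_integral_exp_quotient hg hD hgN hDC hDG
  have hε : Tendsto (fun ε : ℝ => ε) (𝓝[>] 0) (𝓝 0) :=
    tendsto_nhdsWithin_of_tendsto_nhds tendsto_id
  rw [integral_add G_integrable (g_sq_integrable.div_const 2), integral_div] at upper
  have lower_integral : ∫ x, (0 + (2 * g x) ^ 2 / 2) ∂ν = 2 * ∫ x, g x ^ 2 ∂ν := by
    rw [← integral_const_mul]
    congr with x
    ring
  rw [lower_integral] at lower
  -- Both sides of `h` agree up to first order in `ε`; the claim compares their second orders.
  have second_order := le_of_tendsto_of_tendsto (lower.const_mul c)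
    ((((hε.mul upper).const_add a).pow 2).add (upper.const_mul (2 * c))) <| by
      filter_upwards [self_mem_nhdsWithin] with ε (hε0 : 0 < ε)
      have := h ε hε0
      simp only [mul_zero, add_zero, integral_const_mul, ← ha, ← hc]
      field_simp
      rw [← sub_nonneg] at this ⊢
      refine this.trans_eq ?_
      ring_nf
  linarith

/-! ### The Brascamp–Lieb inequality -/

/-- The midpoint form of the statement that `ρ = exp (-V)` with `Hess V (z) ≥ diag (a z i)⁻²` at
every `z`: the number `a z i` is the length scale of `ρ` at `z` in the direction `i`. -/
structure LogConcaveAtScale {n : ℕ} (a : (Fin n → ℝ) → Fin n → ℝ) (ρ : (Fin n → ℝ) → ℝ≥0∞) :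
    Prop where
  scale_ne_zero : ∀ z, ρ z ≠ 0 → ∀ i, a z i ≠ 0
  mul_le : ∀ z h, ρ (z + h) * ρ (z - h) ≤
    ENNReal.ofReal (Real.exp (-∑ i, (h i / a z i) ^ 2)) * ρ z ^ 2

theorem LogConcaveAtScale.indicator {n : ℕ} {a : (Fin n → ℝ) → Fin n → ℝ}
    {ρ : (Fin n → ℝ) → ℝ≥0∞} (hρ : LogConcaveAtScale a ρ) {s : Set (Fin n → ℝ)}
    (hs : Convex ℝ s) : LogConcaveAtScale a (s.indicator ρ) where
  scale_ne_zero z hz := hρ.scale_ne_zero z fun h => hz (by simp [Set.indicator, h])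
  mul_le z h := by
    by_cases hmem : z + h ∈ s ∧ z - h ∈ s
    · have hz : z ∈ s := by
        convert hs.midpoint_mem hmem.1 hmem.2
        rw [midpoint_add_sub]
      simpa only [Set.indicator_of_mem hz, Set.indicator_of_mem hmem.1,
        Set.indicator_of_mem hmem.2] using hρ.mul_le z h
    · rcases not_and_or.1 hmem with h' | h' <;> simp [h']

theorem sq_norm_le_sum_sq {ι : Type*} [Fintype ι] (s : ι → ℝ) : ‖s‖ ^ 2 ≤ ∑ i, s i ^ 2 := by
  have h0 : 0 ≤ ∑ i, s i ^ 2 := by positivity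
  rw [← Real.le_sqrt (norm_nonneg s) h0, pi_norm_le_iff_of_nonneg (Real.sqrt_nonneg _)]
  exact fun i => Real.abs_le_sqrt
    (Finset.single_le_sum (f := fun i => s i ^ 2) (fun i _ => sq_nonneg _) (Finset.mem_univ i))

/-- The difference quotient at `z` along `a z * s`, penalised by `|s|² / 2`; `hopfLaxSlope` is its
supremum over `s`. -/
noncomputable def penalizedSlope {n : ℕ} (a : (Fin n → ℝ) → Fin n → ℝ) (g : (Fin n → ℝ) → ℝ)
    (ε : ℝ) (z s : Fin n → ℝ) : ℝ :=
  (g (z + ε • (a z * s)) - g z) / ε - (∑ i, s i ^ 2) / 2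

/-- The Hopf–Lax slope of `g` at `z` and time `ε`, relative to the quadratic cost with length scales
`a z i`.  The sup-convolution of `g` with this cost is `g z + ε * hopfLaxSlope a g ε z`. -/
noncomputable def hopfLaxSlope {n : ℕ} (a : (Fin n → ℝ) → Fin n → ℝ) (g : (Fin n → ℝ) → ℝ)
    (ε : ℝ) (z : Fin n → ℝ) : ℝ :=
  ⨆ s, penalizedSlope a g ε z s

section HopfLax

variable {n : ℕ} {a : (Fin n → ℝ) → Fin n → ℝ} {g : (Fin n → ℝ) → ℝ} {K : NNReal} {ε : ℝ}

theorem penalizedSlope_le (hg : LipschitzWith K g) (hε : 0 < ε) (z s : Fin n → ℝ) :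
    penalizedSlope a g ε z s ≤ K * ‖a z‖ * ‖s‖ - ‖s‖ ^ 2 / 2 := by
  have lipschitz : (g (z + ε • (a z * s)) - g z) / ε ≤ K * ‖a z‖ * ‖s‖ := by
    rw [div_le_iff₀ hε]
    calc g (z + ε • (a z * s)) - g z ≤ K * ‖(z + ε • (a z * s)) - z‖ :=
          (le_abs_self _).trans (hg.norm_sub_le _ _)
      _ ≤ K * (ε * (‖a z‖ * ‖s‖)) := by
          rw [add_sub_cancel_left, norm_smul, Real.norm_of_nonneg hε.le]
          gcongr
          exact norm_mul_le _ _
      _ = K * ‖a z‖ * ‖s‖ * ε := by ring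
  have := sq_norm_le_sum_sq s
  unfold penalizedSlope
  linarith

theorem penalizedSlope_le_sq (hg : LipschitzWith K g) (hε : 0 < ε) (z s : Fin n → ℝ) :
    penalizedSlope a g ε z s ≤ (K * ‖a z‖) ^ 2 / 2 :=
  (penalizedSlope_le hg hε z s).trans (by linarith [sq_nonneg (K * ‖a z‖ - ‖s‖)])

theorem bddAbove_range_penalizedSlope (hg : LipschitzWith K g) (hε : 0 < ε) (z : Fin n → ℝ) :
    BddAbove (Set.range (penalizedSlope a g ε z)) :=
  ⟨_, Set.forall_mem_range.2 (penalizedSlope_le_sq hg hε z)⟩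

theorem hopfLaxSlope_nonneg (hg : LipschitzWith K g) (hε : 0 < ε) (z : Fin n → ℝ) :
    0 ≤ hopfLaxSlope a g ε z :=
  le_ciSup_of_le (bddAbove_range_penalizedSlope hg hε z) 0 (by simp [penalizedSlope])

theorem hopfLaxSlope_le (hg : LipschitzWith K g) (hε : 0 < ε) (z : Fin n → ℝ) :
    hopfLaxSlope a g ε z ≤ (K * ‖a z‖) ^ 2 / 2 :=
  ciSup_le (penalizedSlope_le_sq hg hε z)

theorem two_mul_sub_sum_sq_le (hg : LipschitzWith K g) (hε : 0 < ε) {z : Fin n → ℝ}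
    (hz : ∀ i, a z i ≠ 0) (h : Fin n → ℝ) :
    ε * (2 * g (z + h)) - ∑ i, (h i / a z i) ^ 2 ≤
      2 * (ε * g z + ε ^ 2 * hopfLaxSlope a g ε z) := by
  set s : Fin n → ℝ := fun i => h i / (ε * a z i) with hs
  have h_eq : ε • (a z * s) = h := by
    ext i
    have := hz i
    simp only [hs, Pi.smul_apply, Pi.mul_apply, smul_eq_mul]
    field_simp
  have slope : penalizedSlope a g ε z s ≤ hopfLaxSlope a g ε z :=
    le_ciSup (bddAbove_range_penalizedSlope hg hε z) s
  have cost : ∑ i, (h i / a z i) ^ 2 = ε ^ 2 * ∑ i, s i ^ 2 := by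
    rw [Finset.mul_sum]
    refine Finset.sum_congr rfl fun i _ => ?_
    simp only [hs]
    field_simp
  calc _ = 2 * (ε * g z + ε ^ 2 * penalizedSlope a g ε z s) := by
        rw [cost, penalizedSlope, h_eq]
        field_simp
        ring
    _ ≤ _ := by gcongr

theorem measurable_hopfLaxSlope (hg : LipschitzWith K g) (ha : Continuous a) (hε : 0 < ε) :
    Measurable (hopfLaxSlope a g ε) := by
  refine (lowerSemicontinuous_ciSup (bddAbove_range_penalizedSlope hg hε) fun s => ?_).measurable
  have := hg.continuous
  unfold penalizedSlope
  exact Continuous.lowerSemicontinuous (by fun_prop)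

theorem eventually_abs_penalizedSlope_sub_le {z : Fin n → ℝ} (hd : DifferentiableAt ℝ g z)
    (R : ℝ) {η : ℝ} (hη : 0 < η) :
    ∀ᶠ ε in 𝓝[>] 0, ∀ s, ‖s‖ ≤ R →
      |penalizedSlope a g ε z s - (fderiv ℝ g z (a z * s) - (∑ i, s i ^ 2) / 2)| ≤ η := by
  rcases lt_or_ge R 0 with hR | hR
  · exact Eventually.of_forall fun ε s hs => absurd (norm_nonneg s) (not_le.2 (hs.trans_lt hR))
  set M := ‖a z‖ * R + 1
  have hM : 0 < M := by positivity
  have linear_approx : ∀ᶠ w in 𝓝 (0 : Fin n → ℝ),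
      ‖g (z + w) - g z - fderiv ℝ g z w‖ ≤ η / M * ‖w‖ :=
    (hasFDerivAt_iff_isLittleO_nhds_zero.1 hd.hasFDerivAt).def (by positivity)
  obtain ⟨δ, hδ, hball⟩ := Metric.eventually_nhds_iff.1 linear_approx
  filter_upwards [Ioo_mem_nhdsGT (div_pos hδ hM)] with ε ⟨hε, hεδ⟩ s hs
  have norm_le : ‖a z * s‖ ≤ M := by
    calc ‖a z * s‖ ≤ ‖a z‖ * R := (norm_mul_le _ _).trans (by gcongr)
      _ ≤ M := by simp [M]
  have norm_smul_le : ‖ε • (a z * s)‖ ≤ ε * M := by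
    rw [norm_smul, Real.norm_of_nonneg hε.le]
    gcongr
  have approx := hball (y := ε • (a z * s)) <| by
    rw [dist_zero_right]
    exact norm_smul_le.trans_lt ((lt_div_iff₀ hM).1 hεδ)
  have quotient : penalizedSlope a g ε z s - (fderiv ℝ g z (a z * s) - (∑ i, s i ^ 2) / 2) =
      (g (z + ε • (a z * s)) - g z - fderiv ℝ g z (ε • (a z * s))) / ε := by
    rw [map_smul, smul_eq_mul]
    unfold penalizedSlope
    field_simp
    ring
  rw [quotient, abs_div, abs_of_pos hε, div_le_iff₀ hε]
  calc _ ≤ η / M * ‖ε • (a z * s)‖ := approx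
    _ ≤ η / M * (ε * M) := by gcongr
    _ = η * ε := by field_simp

theorem partialDeriv_eq_fderiv {z : Fin n → ℝ} (hd : DifferentiableAt ℝ g z) (i : Fin n) :
    partialDeriv i g z = fderiv ℝ g z (Pi.single i 1) :=
  hd.lineDeriv_eq_fderiv

theorem fderiv_apply_eq_sum_partialDeriv {z : Fin n → ℝ} (hd : DifferentiableAt ℝ g z)
    (w : Fin n → ℝ) : fderiv ℝ g z w = ∑ i, w i * partialDeriv i g z := by
  simp only [partialDeriv_eq_fderiv hd]
  conv_lhs => rw [← Finset.univ_sum_single w, map_sum]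
  refine Finset.sum_congr rfl fun i _ => ?_
  rw [← smul_eq_mul, ← map_smul, ← Pi.single_smul, smul_eq_mul, mul_one]

theorem tendsto_hopfLaxSlope (hg : LipschitzWith K g) {z : Fin n → ℝ}
    (hd : DifferentiableAt ℝ g z) :
    Tendsto (fun ε => hopfLaxSlope a g ε z) (𝓝[>] 0)
      (𝓝 ((∑ i, (a z i * partialDeriv i g z) ^ 2) / 2)) := by
  set b : Fin n → ℝ := fun i => a z i * partialDeriv i g z with hb
  -- The linearised problem `sup_s (⟨b, s⟩ - |s|² / 2)` is solved by `s = b`.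
  have linearised : ∀ s, fderiv ℝ g z (a z * s) - (∑ i, s i ^ 2) / 2 =
      (∑ i, b i ^ 2) / 2 - (∑ i, (b i - s i) ^ 2) / 2 := fun s => by
    rw [fderiv_apply_eq_sum_partialDeriv hd, Finset.sum_div, Finset.sum_div, Finset.sum_div,
      ← Finset.sum_sub_distrib, ← Finset.sum_sub_distrib]
    exact Finset.sum_congr rfl fun i _ => by simp only [hb, Pi.mul_apply]; ring
  rw [Metric.tendsto_nhds]
  intro η hη
  filter_upwards [self_mem_nhdsWithin, eventually_abs_penalizedSlope_sub_le (a := a) hd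
    (max (2 * (K * ‖a z‖)) ‖b‖) (half_pos hη)] with ε hε happrox
  simp only [linearised] at happrox
  have lower : (∑ i, b i ^ 2) / 2 - η / 2 ≤ hopfLaxSlope a g ε z := by
    refine le_ciSup_of_le (bddAbove_range_penalizedSlope hg hε z) b ?_
    have := (abs_le.1 (happrox b (le_max_right _ _))).1
    simp only [sub_self, ne_eq, OfNat.ofNat_ne_zero, not_false_eq_true, zero_pow,
      Finset.sum_const_zero, zero_div, sub_zero] at this
    linarith
  have upper : hopfLaxSlope a g ε z ≤ (∑ i, b i ^ 2) / 2 + η / 2 := ciSup_le fun s => by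
    rcases le_or_gt ‖s‖ (2 * (K * ‖a z‖)) with hs | hs
    · have := (abs_le.1 (happrox s (hs.trans (le_max_left _ _)))).2
      have : 0 ≤ ∑ i, (b i - s i) ^ 2 := by positivity
      linarith
    · have := penalizedSlope_le (a := a) hg hε z s
      have : 0 ≤ ∑ i, b i ^ 2 := by positivity
      nlinarith [norm_nonneg s]
  rw [Real.dist_eq, abs_lt]
  constructor <;> linarith

end HopfLax

theorem measurable_partialDeriv {n : ℕ} {f : (Fin n → ℝ) → ℝ} (hf : Continuous f) (i : Fin n) :
    Measurable (partialDeriv i f) :=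
  measurable_lineDeriv hf

namespace LogConcaveAtScale

variable {n : ℕ} {a : (Fin n → ℝ) → Fin n → ℝ} {ρ : (Fin n → ℝ) → ℝ≥0∞} {g : (Fin n → ℝ) → ℝ}
  {K : NNReal} {ε : ℝ}

theorem exp_mul_le_sq (hρ : LogConcaveAtScale a ρ) (hg : LipschitzWith K g) (hε : 0 < ε)
    (z h : Fin n → ℝ) :
    ρ (z + h) * ENNReal.ofReal (Real.exp (ε * (2 * g (z + h)))) * ρ (z - h) ≤
      (ρ z * ENNReal.ofReal (Real.exp (ε * g z + ε ^ 2 * hopfLaxSlope a g ε z))) ^ 2 := by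
  rcases eq_or_ne (ρ z) 0 with hz | hz
  · have := hρ.mul_le z h
    rw [hz, zero_pow two_ne_zero, mul_zero, nonpos_iff_eq_zero] at this
    rw [mul_right_comm, this, zero_mul]
    exact zero_le
  calc _ = ENNReal.ofReal (Real.exp (ε * (2 * g (z + h)))) * (ρ (z + h) * ρ (z - h)) := by ring
    _ ≤ ENNReal.ofReal (Real.exp (ε * (2 * g (z + h)))) *
        (ENNReal.ofReal (Real.exp (-∑ i, (h i / a z i) ^ 2)) * ρ z ^ 2) := by
        exact mul_le_mul' le_rfl (hρ.mul_le z h)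
    _ = ENNReal.ofReal (Real.exp (ε * (2 * g (z + h)) - ∑ i, (h i / a z i) ^ 2)) * ρ z ^ 2 := by
        rw [← mul_assoc, ← ENNReal.ofReal_mul (Real.exp_pos _).le, ← Real.exp_add, ← sub_eq_add_neg]
    _ ≤ ENNReal.ofReal (Real.exp (2 * (ε * g z + ε ^ 2 * hopfLaxSlope a g ε z))) * ρ z ^ 2 := by
        gcongr
        exact two_mul_sub_sum_sq_le hg hε (hρ.scale_ne_zero z hz) h
    _ = _ := by
        rw [mul_pow, ← ENNReal.ofReal_pow (Real.exp_pos _).le, ← Real.exp_nat_mul, mul_comm,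
          Nat.cast_two]

theorem lintegral_exp_mul_le_sq (hρ : LogConcaveAtScale a ρ) (hρ_meas : AEMeasurable ρ volume)
    (ha : Continuous a) (hg : LipschitzWith K g) (hε : 0 < ε) :
    (∫⁻ x, ENNReal.ofReal (Real.exp (ε * (2 * g x))) ∂volume.withDensity ρ) *
        volume.withDensity ρ Set.univ ≤
      (∫⁻ x, ENNReal.ofReal (Real.exp (ε * g x + ε ^ 2 * hopfLaxSlope a g ε x))
        ∂volume.withDensity ρ) ^ 2 := by
  have hgm := hg.continuous.measurable
  have hD := measurable_hopfLaxSlope (ε := ε) hg ha hε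
  have hexp : Measurable fun x =>
      ENNReal.ofReal (Real.exp (ε * g x + ε ^ 2 * hopfLaxSlope a g ε x)) := by fun_prop
  rw [lintegral_withDensity_eq_lintegral_mul₀ hρ_meas (by fun_prop),
    lintegral_withDensity_eq_lintegral_mul₀ hρ_meas (by fun_prop),
    withDensity_apply _ MeasurableSet.univ, Measure.restrict_univ]
  exact (MidpointPrekopaLeindler.volume_pi n).of_aemeasurable (hρ_meas.mul hexp.aemeasurable)
    (hρ.exp_mul_le_sq hg hε)

theorem real_mul_integral_exp_le_sq (hρ : LogConcaveAtScale a ρ)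
    (hρ_meas : AEMeasurable ρ volume) (ha : Continuous a) (hg : LipschitzWith K g) (hε : 0 < ε)
    (hexp : Integrable (fun x => Real.exp (ε * g x + ε ^ 2 * hopfLaxSlope a g ε x))
      (volume.withDensity ρ)) :
    (volume.withDensity ρ).real Set.univ *
        ∫ x, Real.exp (ε * (2 * g x)) ∂volume.withDensity ρ ≤
      (∫ x, Real.exp (ε * g x + ε ^ 2 * hopfLaxSlope a g ε x) ∂volume.withDensity ρ) ^ 2 := by
  have g_measurable := hg.continuous.measurable
  rw [integral_eq_lintegral_of_nonneg_ae (ae_of_all _ fun x => (Real.exp_pos _).le) (by fun_prop),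
    integral_eq_lintegral_of_nonneg_ae (ae_of_all _ fun x => (Real.exp_pos _).le)
      hexp.aestronglyMeasurable, mul_comm, measureReal_def, ← ENNReal.toReal_mul,
    ← ENNReal.toReal_pow]
  exact ENNReal.toReal_mono (ENNReal.pow_ne_top hexp.lintegral_lt_top.ne)
    (hρ.lintegral_exp_mul_le_sq hρ_meas ha hg hε)

theorem integral_sq_le_of_lipschitzWith (hρ : LogConcaveAtScale a ρ)
    (hρ_meas : AEMeasurable ρ volume) [IsFiniteMeasure (volume.withDensity ρ)]
    (ha : Continuous a) (hg : LipschitzWith K g) {s : Set (Fin n → ℝ)}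
    (hs : Bornology.IsBounded s) (hρs : ∀ x ∉ s, ρ x = 0) :
    (volume.withDensity ρ).real Set.univ * ∫ x, g x ^ 2 ∂volume.withDensity ρ ≤
      (∫ x, g x ∂volume.withDensity ρ) ^ 2 + (volume.withDensity ρ).real Set.univ *
        ∫ x, ∑ i, (a x i * partialDeriv i g x) ^ 2 ∂volume.withDensity ρ := by
  set ν := volume.withDensity ρ
  have ae_mem : ∀ᵐ x ∂ν, x ∈ closure s := by
    refine (ae_withDensity_iff' hρ_meas).2 (ae_of_all _ fun x hx => subset_closure ?_)
    exact not_not.1 fun h => hx (hρs x h)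
  have hcpt : IsCompact (closure s) := hs.isCompact_closure
  obtain ⟨N, hN⟩ := hcpt.exists_bound_of_continuousOn hg.continuous.continuousOn
  obtain ⟨A, hA⟩ := hcpt.exists_bound_of_continuousOn ha.continuousOn
  have slope_le : ∀ᵐ x ∂ν, ∀ ε > 0, |hopfLaxSlope a g ε x| ≤ (K * A) ^ 2 / 2 := by
    filter_upwards [ae_mem] with x hx ε hε
    rw [abs_of_nonneg (hopfLaxSlope_nonneg hg hε x)]
    refine (hopfLaxSlope_le hg hε x).trans ?_
    gcongr
    exact hA x hx
  have g_measurable := hg.continuous.measurable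
  have key := integral_sq_le_of_integral_exp_mul_le_sq (D := hopfLaxSlope a g)
    (G := fun x => (∑ i, (a x i * partialDeriv i g x) ^ 2) / 2) g_measurable.aemeasurable
    (fun ε hε => (measurable_hopfLaxSlope hg ha hε).aemeasurable)
    (ae_mem.mono fun x hx => hN x hx) slope_le
    ((withDensity_absolutelyContinuous volume ρ).ae_le
      (hg.ae_differentiableAt.mono fun x hx => tendsto_hopfLaxSlope hg hx))
    (by
      have := fun i => measurable_partialDeriv hg.continuous i
      fun_prop) fun ε hε => ?_
  · rwa [integral_div, mul_div_cancel₀ _ two_ne_zero] at key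
  have := measurable_hopfLaxSlope hg ha hε
  refine hρ.real_mul_integral_exp_le_sq hρ_meas ha hg hε <|
    .of_bound (by fun_prop) (Real.exp (ε * N + ε ^ 2 * ((K * A) ^ 2 / 2))) ?_
  filter_upwards [ae_mem, slope_le] with x hx hDx
  rw [Real.norm_eq_abs, Real.abs_exp]
  gcongr
  exacts [(le_abs_self _).trans (hN x hx), (le_abs_self _).trans (hDx ε hε)]

theorem setLIntegral_ball_sq_le (hρ : LogConcaveAtScale a ρ) (hρ_meas : AEMeasurable ρ volume)
    [IsFiniteMeasure (volume.withDensity ρ)] (ha : Continuous a) (hg : LocallyLipschitz g)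
    (r : ℝ) :
    volume.withDensity ρ (Metric.ball 0 r) *
        ∫⁻ x in Metric.ball 0 r, ENNReal.ofReal (g x ^ 2) ∂volume.withDensity ρ ≤
      ENNReal.ofReal ((∫ x in Metric.ball 0 r, g x ∂volume.withDensity ρ) ^ 2) +
        volume.withDensity ρ (Metric.ball 0 r) * ∫⁻ x in Metric.ball 0 r,
          ∑ i, ENNReal.ofReal ((a x i * partialDeriv i g x) ^ 2) ∂volume.withDensity ρ := by
  set ν := volume.withDensity ρ
  set B := Metric.ball (0 : Fin n → ℝ) r
  have B_measurable : MeasurableSet B := measurableSet_ball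
  obtain ⟨K, hK⟩ := hg.locallyLipschitzOn.exists_lipschitzOnWith_of_compact
    (isCompact_closedBall (0 : Fin n → ℝ) r)
  obtain ⟨G, hG, hgG⟩ := (hK.mono Metric.ball_subset_closedBall).extend_real
  have partialDeriv_eq : ∀ i, ∀ x ∈ B, partialDeriv i G x = partialDeriv i g x := fun i x hx =>
    (Filter.eventuallyEq_of_mem (Metric.isOpen_ball.mem_nhds hx) hgG.symm).lineDeriv_eq
  have restrict_eq : ν.restrict B = volume.withDensity (B.indicator ρ) := by
    rw [restrict_withDensity B_measurable, withDensity_indicator B_measurable]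
  have := isFiniteMeasureRestrict ν B
  rw [restrict_eq] at this
  have lipschitz_case := (hρ.indicator (convex_ball 0 r)).integral_sq_le_of_lipschitzWith
    (hρ_meas.indicator B_measurable) ha hG Metric.isBounded_ball
    (fun x hx => Set.indicator_of_notMem hx ρ)
  rw [← restrict_eq, measureReal_restrict_apply_univ,
    ← setIntegral_congr_fun B_measurable fun x hx => congrArg (· ^ 2) (hgG hx),
    ← setIntegral_congr_fun B_measurable hgG,
    setIntegral_congr_fun B_measurable fun x hx => Finset.sum_congr rfl fun i _ =>
      congrArg (fun d => (a x i * d) ^ 2) (partialDeriv_eq i x hx)] at lipschitz_case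
  have sq_integrable : IntegrableOn (fun x => g x ^ 2) B ν :=
    ((hg.continuous.pow 2).continuousOn.integrableOn_compact
      (isCompact_closedBall 0 r)).mono_set Metric.ball_subset_closedBall
  have ofReal_slope_le : ENNReal.ofReal (∫ x in B, ∑ i, (a x i * partialDeriv i g x) ^ 2 ∂ν) ≤
      ∫⁻ x in B, ∑ i, ENNReal.ofReal ((a x i * partialDeriv i g x) ^ 2) ∂ν := by
    have := fun i => measurable_partialDeriv hg.continuous i
    simp only [← ENNReal.ofReal_sum_of_nonneg fun _ _ => sq_nonneg _]
    rw [integral_eq_lintegral_of_nonneg_ae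
      (ae_of_all _ fun x => Finset.sum_nonneg fun i _ => sq_nonneg _) (by fun_prop)]
    exact ENNReal.ofReal_toReal_le
  rw [← ofReal_integral_eq_lintegral_ofReal sq_integrable (ae_of_all _ fun x => sq_nonneg _),
    ← ofReal_measureReal, ← ENNReal.ofReal_mul measureReal_nonneg]
  refine (ENNReal.ofReal_le_ofReal lipschitz_case).trans (ENNReal.ofReal_add_le.trans ?_)
  rw [ENNReal.ofReal_mul measureReal_nonneg]
  gcongr

theorem lintegral_sq_le (hρ : LogConcaveAtScale a ρ) (hρ_meas : AEMeasurable ρ volume)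
    [IsFiniteMeasure (volume.withDensity ρ)] (ha : Continuous a) (hg : LocallyLipschitz g)
    (hg_int : Integrable g (volume.withDensity ρ)) :
    volume.withDensity ρ Set.univ * ∫⁻ x, ENNReal.ofReal (g x ^ 2) ∂volume.withDensity ρ ≤
      ENNReal.ofReal ((∫ x, g x ∂volume.withDensity ρ) ^ 2) +
        volume.withDensity ρ Set.univ *
          ∫⁻ x, ∑ i, ENNReal.ofReal ((a x i * partialDeriv i g x) ^ 2) ∂volume.withDensity ρ := by
  set ν := volume.withDensity ρ
  rcases eq_or_ne ν 0 with hν | hν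
  · simp [hν]
  let B : ℕ → Set (Fin n → ℝ) := fun N => Metric.ball 0 N
  have B_measurable : ∀ N, MeasurableSet (B N) := fun N => measurableSet_ball
  have B_mono : Monotone B := fun M N h => Metric.ball_subset_ball (Nat.cast_le.2 h)
  have iUnion_B : ⋃ N, B N = Set.univ := Metric.iUnion_ball_nat 0
  have measure_tendsto : ∀ m : Measure (Fin n → ℝ),
      Tendsto (fun N => m (B N)) atTop (𝓝 (m Set.univ)) := fun m => by
    rw [← iUnion_B]
    exact tendsto_measure_iUnion_atTop B_mono
  have sq_tendsto : Tendsto (fun N => ∫⁻ x in B N, ENNReal.ofReal (g x ^ 2) ∂ν) atTop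
      (𝓝 (∫⁻ x, ENNReal.ofReal (g x ^ 2) ∂ν)) := by
    simpa only [withDensity_apply _ (B_measurable _), withDensity_apply _ MeasurableSet.univ,
      Measure.restrict_univ] using
      measure_tendsto (ν.withDensity fun x => ENNReal.ofReal (g x ^ 2))
  have mean_tendsto : Tendsto (fun N => ∫ x in B N, g x ∂ν) atTop (𝓝 (∫ x, g x ∂ν)) := by
    simpa only [iUnion_B, setIntegral_univ] using
      tendsto_setIntegral_of_monotone B_measurable B_mono hg_int.integrableOn
  refine le_of_tendsto_of_tendsto'
    (ENNReal.Tendsto.mul (measure_tendsto ν) (.inl ?_) sq_tendsto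
      (.inr (measure_ne_top ν _)))
    ((ENNReal.tendsto_ofReal (mean_tendsto.pow 2)).add_const _)
    fun N => (hρ.setLIntegral_ball_sq_le hρ_meas ha hg N).trans ?_
  · exact mt Measure.measure_univ_eq_zero.1 hν
  · gcongr
    exacts [Set.subset_univ _, Measure.restrict_le_self]

end LogConcaveAtScale

/-! ### The power change of variables on the orthant -/

theorem ae_differentiableAt_of_locallyLipschitz {E : Type*} [NormedAddCommGroup E]
    [NormedSpace ℝ E] [FiniteDimensional ℝ E] [MeasurableSpace E] [BorelSpace E] {μ : Measure E}
    [μ.IsAddHaarMeasure] {f : E → ℝ} (hf : LocallyLipschitz f) :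
    ∀ᵐ x ∂μ, DifferentiableAt ℝ f x := by
  have := FiniteDimensional.proper ℝ E
  have ae_within : ∀ N : ℕ, ∀ᵐ x ∂μ, x ∈ Metric.closedBall (0 : E) N →
      DifferentiableWithinAt ℝ f (Metric.closedBall 0 N) x := fun N => by
    obtain ⟨K, hK⟩ := hf.locallyLipschitzOn.exists_lipschitzOnWith_of_compact
      (isCompact_closedBall (0 : E) N)
    exact hK.ae_differentiableWithinAt_of_mem
  filter_upwards [ae_all_iff.2 ae_within] with x hx
  obtain ⟨N, hN⟩ := exists_nat_gt ‖x‖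
  exact (hx N (mem_closedBall_zero_iff.2 hN.le)).differentiableAt
    (Metric.closedBall_mem_nhds_of_mem (mem_ball_zero_iff.2 hN))

theorem map_withDensity_comp {X Y : Type*} [MeasurableSpace X] [MeasurableSpace Y] {μ : Measure X}
    {f : X → Y} {w : Y → ℝ≥0∞} (hf : Measurable f) (hw : AEMeasurable w (μ.map f)) :
    (μ.withDensity (w ∘ f)).map f = (μ.map f).withDensity w := by
  ext s hs
  rw [Measure.map_apply hf hs, withDensity_apply _ (hf hs), withDensity_apply _ hs,
    Measure.restrict_map hf hs, lintegral_map' ?_ hf.aemeasurable]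
  · rfl
  · rw [← Measure.restrict_map hf hs]
    exact hw.restrict

theorem measurableSet_posOrthant (n : ℕ) : MeasurableSet (posOrthant n) := by
  simp only [posOrthant, measurableSet_setOfPred]
  fun_prop

theorem FracConvexOnOrthant.exp_neg_mul_le_sq {n : ℕ} {p : ℝ} {φ : (Fin n → ℝ) → EReal}
    (hφ : FracConvexOnOrthant (1 / p) φ) (hφ_bot : ∀ x, φ x ≠ ⊥) {z h : Fin n → ℝ}
    (hadd : z + h ∈ posOrthant n) (hsub : z - h ∈ posOrthant n) :
    EReal.exp (-φ fun i => (z + h) i ^ p) * EReal.exp (-φ fun i => (z - h) i ^ p) ≤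
      EReal.exp (-φ fun i => z i ^ p) ^ 2 := by
  have midpoint_le := hφ.2 _ hadd _ hsub (1 / 2) (1 / 2) (by norm_num) (by norm_num) (by norm_num)
  rw [← smul_add, add_add_sub_cancel, ← two_smul ℝ z, smul_smul, one_div_mul_cancel two_ne_zero,
    one_smul] at midpoint_le
  simp only [one_div_one_div] at midpoint_le
  set X := φ fun i => (z + h) i ^ p
  set Y := φ fun i => (z - h) i ^ p
  set Z := φ fun i => z i ^ p
  have hX : EReal.exp X ≠ 0 := mt EReal.exp_eq_zero_iff.1 (hφ_bot _)
  have hY : EReal.exp Y ≠ 0 := mt EReal.exp_eq_zero_iff.1 (hφ_bot _)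
  have sq_le : EReal.exp Z ^ 2 ≤ EReal.exp X * EReal.exp Y :=
    calc EReal.exp Z ^ 2
        ≤ EReal.exp (((1 / 2 : ℝ) : EReal) * X + ((1 / 2 : ℝ) : EReal) * Y) ^ 2 := by
          gcongr
      _ = EReal.exp X * EReal.exp Y := by
          rw [EReal.exp_add, mul_comm _ X, mul_comm _ Y, EReal.exp_mul, EReal.exp_mul, mul_pow,
            ← ENNReal.rpow_mul_natCast, ← ENNReal.rpow_mul_natCast]
          norm_num
  rw [EReal.exp_neg, EReal.exp_neg, EReal.exp_neg, ← ENNReal.mul_inv (.inl hX) (.inr hY),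
    ← ENNReal.inv_pow]
  exact ENNReal.inv_le_inv.2 sq_le

theorem rpow_add_mul_rpow_sub_le {z h q : ℝ} (hadd : 0 < z + h) (hsub : 0 < z - h) (hq : 0 ≤ q) :
    (z + h) ^ q * (z - h) ^ q ≤ Real.exp (-(q * (h / z) ^ 2)) * (z ^ q) ^ 2 := by
  have hz : 0 < z := by linarith
  calc (z + h) ^ q * (z - h) ^ q = (z ^ 2 * (1 - (h / z) ^ 2)) ^ q := by
        rw [← Real.mul_rpow hadd.le hsub.le]
        congr 1
        field_simp
        ring
    _ ≤ (z ^ 2 * Real.exp (-(h / z) ^ 2)) ^ q := by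
        gcongr
        · rw [mul_sub, mul_one, ← mul_pow, mul_div_cancel₀ _ hz.ne']
          nlinarith
        · exact Real.one_sub_le_exp_neg _
    _ = _ := by
        rw [Real.mul_rpow (sq_nonneg z) (Real.exp_pos _).le, ← Real.exp_mul, mul_comm,
          ← Real.rpow_pow_comm hz.le, neg_mul, mul_comm q]

/-- The map `(y₁, …, yₙ) ↦ (y₁ ^ p, …, yₙ ^ p)`, a change of variables of the orthant which turns
`1/p`-convexity into convexity. -/
noncomputable def coordPow {n : ℕ} (p : ℝ) (y : Fin n → ℝ) : Fin n → ℝ := fun i => y i ^ p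

/-- The Jacobian determinant of `coordPow p` on the orthant. -/
noncomputable def coordPowJacobian {n : ℕ} (p : ℝ) (y : Fin n → ℝ) : ℝ := ∏ i, p * y i ^ (p - 1)

/-- The density on the orthant which `coordPow p` pushes forward to the density `w`. -/
noncomputable def powDensity {n : ℕ} (p : ℝ) (w : (Fin n → ℝ) → ℝ≥0∞) : (Fin n → ℝ) → ℝ≥0∞ :=
  (posOrthant n).indicator fun y => ENNReal.ofReal (coordPowJacobian p y) * w (coordPow p y)

section CoordPow

variable {n : ℕ} {p : ℝ} {w : (Fin n → ℝ) → ℝ≥0∞} {f : (Fin n → ℝ) → ℝ} {y : Fin n → ℝ}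

theorem coordPow_mem_posOrthant (hy : y ∈ posOrthant n) : coordPow p y ∈ posOrthant n :=
  fun i => Real.rpow_pos_of_pos (hy i) p

theorem bijOn_coordPow (hp : p ≠ 0) : Set.BijOn (coordPow p) (posOrthant n) (posOrthant n) := by
  refine Set.BijOn.mk (fun _ => coordPow_mem_posOrthant) (fun x hx y hy h => funext fun i => ?_)
    fun y hy => ⟨coordPow p⁻¹ y, coordPow_mem_posOrthant hy, funext fun i => ?_⟩
  · exact Real.rpow_left_injOn hp (hx i).le (hy i).le (congrFun h i)
  · exact Real.rpow_inv_rpow (hy i).le hp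

theorem measurable_coordPow : Measurable (coordPow p : (Fin n → ℝ) → Fin n → ℝ) := by
  unfold coordPow
  fun_prop

theorem measurable_coordPowJacobian : Measurable (coordPowJacobian p : (Fin n → ℝ) → ℝ) := by
  unfold coordPowJacobian
  fun_prop

theorem locallyLipschitz_coordPow (hp : 1 ≤ p) :
    LocallyLipschitz (coordPow p : (Fin n → ℝ) → Fin n → ℝ) := by
  have rpow_contDiff : ContDiff ℝ 1 fun x : ℝ => x ^ p :=
    mod_cast Real.contDiff_rpow_const_of_le (n := 1) (mod_cast hp)
  exact (contDiff_pi.2 fun i => rpow_contDiff.comp (contDiff_apply ℝ ℝ i)).locallyLipschitz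

theorem hasFDerivAt_coordPow (hy : y ∈ posOrthant n) :
    HasFDerivAt (coordPow p) (ContinuousLinearMap.pi fun i =>
      (ContinuousLinearMap.toSpanSingleton ℝ (p * y i ^ (p - 1))).comp
        (ContinuousLinearMap.proj i)) y :=
  hasFDerivAt_pi.2 fun i =>
    (Real.hasDerivAt_rpow_const (.inl (hy i).ne')).hasFDerivAt.comp (f := fun z : Fin n → ℝ => z i)
      y (hasFDerivAt_apply i y)

theorem partialDeriv_comp_coordPow (hy : y ∈ posOrthant n)
    (hf : DifferentiableAt ℝ f (coordPow p y)) (i : Fin n) :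
    partialDeriv i (f ∘ coordPow p) y = p * y i ^ (p - 1) * partialDeriv i f (coordPow p y) := by
  have hF := hasFDerivAt_coordPow (p := p) hy
  rw [partialDeriv_eq_fderiv (hf.comp y hF.differentiableAt), partialDeriv_eq_fderiv hf,
    fderiv_comp y hf hF.differentiableAt, hF.fderiv, ← smul_eq_mul, ← map_smul]
  refine congrArg (fderiv ℝ f (coordPow p y)) (funext fun j => ?_)
  rcases eq_or_ne j i with rfl | h
  · simp
  · simp [h]

theorem det_fderiv_coordPow (hy : y ∈ posOrthant n) :
    (fderiv ℝ (coordPow p) y).det = coordPowJacobian p y := by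
  simp only [(hasFDerivAt_coordPow hy).fderiv, ContinuousLinearMap.det_pi,
    ContinuousLinearMap.det_toSpanSingleton, coordPowJacobian]

theorem coordPowJacobian_pos (hp : 0 < p) (hy : y ∈ posOrthant n) : 0 < coordPowJacobian p y :=
  Finset.prod_pos fun i _ => mul_pos hp (Real.rpow_pos_of_pos (hy i) _)

theorem map_coordPow_withDensity_jacobian (hp : 0 < p) :
    ((volume.restrict (posOrthant n)).withDensity
        fun y => ENNReal.ofReal (coordPowJacobian p y)).map (coordPow p) =
      volume.restrict (posOrthant n) := by
  have bij := bijOn_coordPow (n := n) hp.ne'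
  have change_of_variables := map_withDensity_abs_det_fderiv_eq_addHaar volume
    (measurableSet_posOrthant n).nullMeasurableSet (f := coordPow p)
    (f' := fun y => fderiv ℝ (coordPow p) y) (fun y hy =>
      (hasFDerivAt_coordPow hy).differentiableAt.hasFDerivAt.hasFDerivWithinAt) bij.injOn
  have density_ae_eq : (fun y => ENNReal.ofReal |(fderiv ℝ (coordPow p) y).det|)
      =ᵐ[volume.restrict (posOrthant n)] fun y => ENNReal.ofReal (coordPowJacobian p y) := by
    refine (ae_restrict_iff' (measurableSet_posOrthant n)).2 (ae_of_all _ fun y hy => ?_)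
    simp only [det_fderiv_coordPow hy, abs_of_pos (coordPowJacobian_pos hp hy)]
  rwa [withDensity_congr_ae density_ae_eq, bij.image_eq] at change_of_variables

theorem aemeasurable_comp_coordPow (hp : 0 < p)
    (hw : AEMeasurable w (volume.restrict (posOrthant n))) :
    AEMeasurable (w ∘ coordPow p) (volume.restrict (posOrthant n)) := by
  have jacobian_ne_zero : ∀ᵐ y ∂volume.restrict (posOrthant n),
      ENNReal.ofReal (coordPowJacobian p y) ≠ 0 :=
    (ae_restrict_iff' (measurableSet_posOrthant n)).2 (ae_of_all _ fun y hy =>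
      (ENNReal.ofReal_pos.2 (coordPowJacobian_pos hp hy)).ne')
  rw [← map_coordPow_withDensity_jacobian hp] at hw
  exact (hw.comp_measurable measurable_coordPow).mono_ac (withDensity_absolutelyContinuous'
    measurable_coordPowJacobian.ennreal_ofReal.aemeasurable jacobian_ne_zero)

theorem aemeasurable_powDensity (hp : 0 < p)
    (hw : AEMeasurable w (volume.restrict (posOrthant n))) :
    AEMeasurable (powDensity p w) volume :=
  (aemeasurable_indicator_iff (measurableSet_posOrthant n)).2
    (measurable_coordPowJacobian.ennreal_ofReal.aemeasurable.mul (aemeasurable_comp_coordPow hp hw))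

theorem map_coordPow_powDensity (hp : 0 < p)
    (hw : AEMeasurable w (volume.restrict (posOrthant n))) :
    (volume.withDensity (powDensity p w)).map (coordPow p) =
      (volume.restrict (posOrthant n)).withDensity w := by
  have density_eq : volume.withDensity (powDensity p w) =
      ((volume.restrict (posOrthant n)).withDensity fun y =>
        ENNReal.ofReal (coordPowJacobian p y)).withDensity (w ∘ coordPow p) := by
    rw [powDensity, withDensity_indicator (measurableSet_posOrthant n), ← withDensity_mul₀
      measurable_coordPowJacobian.ennreal_ofReal.aemeasurable (aemeasurable_comp_coordPow hp hw)]
    rfl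
  rw [← map_coordPow_withDensity_jacobian hp] at hw
  rw [density_eq, map_withDensity_comp measurable_coordPow hw, map_coordPow_withDensity_jacobian hp]

theorem coordPowJacobian_mul_le (hp : 1 < p) {z h : Fin n → ℝ} (hadd : z + h ∈ posOrthant n)
    (hsub : z - h ∈ posOrthant n) :
    coordPowJacobian p (z + h) * coordPowJacobian p (z - h) ≤
      Real.exp (-∑ i, (h i / (z i / √(p - 1))) ^ 2) * coordPowJacobian p z ^ 2 := by
  have hp' : 0 ≤ p - 1 := by linarith
  simp only [coordPowJacobian]
  rw [← Finset.sum_neg_distrib, Real.exp_sum, ← Finset.prod_mul_distrib, ← Finset.prod_pow,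
    ← Finset.prod_mul_distrib]
  refine Finset.prod_le_prod (fun i _ => ?_) fun i _ => ?_
  · have := (hadd i).le
    have := (hsub i).le
    positivity
  · calc p * (z + h) i ^ (p - 1) * (p * (z - h) i ^ (p - 1))
        = p ^ 2 * ((z i + h i) ^ (p - 1) * (z i - h i) ^ (p - 1)) := by
          simp only [Pi.add_apply, Pi.sub_apply]
          ring
      _ ≤ p ^ 2 * (Real.exp (-((p - 1) * (h i / z i) ^ 2)) * (z i ^ (p - 1)) ^ 2) := by
          exact mul_le_mul_of_nonneg_left (rpow_add_mul_rpow_sub_le (hadd i) (hsub i) hp')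
            (sq_nonneg p)
      _ = Real.exp (-(h i / (z i / √(p - 1))) ^ 2) * (p * z i ^ (p - 1)) ^ 2 := by
          rw [div_div_eq_mul_div, mul_div_right_comm, mul_pow, Real.sq_sqrt hp', mul_comm (p - 1)]
          ring

theorem logConcaveAtScale_powDensity (hp : 1 < p)
    (hw : ∀ z h, z + h ∈ posOrthant n → z - h ∈ posOrthant n →
      w (coordPow p (z + h)) * w (coordPow p (z - h)) ≤ w (coordPow p z) ^ 2) :
    LogConcaveAtScale (fun z i => z i / √(p - 1)) (powDensity p w) where
  scale_ne_zero z hz i :=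
    div_ne_zero (Set.mem_of_indicator_ne_zero hz i).ne' (Real.sqrt_pos.2 (sub_pos.2 hp)).ne'
  mul_le z h := by
    by_cases hmem : z + h ∈ posOrthant n ∧ z - h ∈ posOrthant n
    · obtain ⟨hadd, hsub⟩ := hmem
      have hz : z ∈ posOrthant n := fun i => by
        have := add_pos (hadd i) (hsub i)
        simp only [Pi.add_apply, Pi.sub_apply] at this
        linarith
      rw [powDensity, Set.indicator_of_mem hadd, Set.indicator_of_mem hsub, Set.indicator_of_mem hz,
        mul_mul_mul_comm, mul_pow, ← mul_assoc (ENNReal.ofReal (Real.exp _)),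
        ← ENNReal.ofReal_mul (coordPowJacobian_pos (by linarith) hadd).le,
        ← ENNReal.ofReal_pow (coordPowJacobian_pos (by linarith) hz).le,
        ← ENNReal.ofReal_mul (Real.exp_pos _).le]
      exact mul_le_mul' (ENNReal.ofReal_le_ofReal (coordPowJacobian_mul_le hp hadd hsub))
        (hw z h hadd hsub)
    · rcases not_and_or.1 hmem with h' | h' <;> simp [powDensity, h']

theorem sum_ofReal_sq_partialDeriv_comp_coordPow (hp : 1 < p) (hy : y ∈ posOrthant n)
    (hf : DifferentiableAt ℝ f (coordPow p y)) :
    ∑ i, ENNReal.ofReal ((y i / √(p - 1) * partialDeriv i (f ∘ coordPow p) y) ^ 2) =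
      ∑ i, ENNReal.ofReal (p ^ 2 / (p - 1) * coordPow p y i ^ 2) *
        ENNReal.ofReal (|partialDeriv i f (coordPow p y)| ^ 2) := by
  have hp' : 0 < p - 1 := by linarith
  refine Finset.sum_congr rfl fun i _ => ?_
  rw [partialDeriv_comp_coordPow hy hf, ← ENNReal.ofReal_mul (by positivity), sq_abs]
  congr 1
  have rpow_eq : coordPow p y i = y i * y i ^ (p - 1) := by
    rw [coordPow, Real.rpow_sub_one (hy i).ne', mul_div_cancel₀ _ (hy i).ne']
  rw [rpow_eq, mul_pow, div_pow, Real.sq_sqrt hp'.le]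
  ring

theorem lintegral_sq_le_posOrthant (hp : 1 < p)
    (hw_meas : AEMeasurable w (volume.restrict (posOrthant n)))
    (hw : ∀ z h, z + h ∈ posOrthant n → z - h ∈ posOrthant n →
      w (coordPow p (z + h)) * w (coordPow p (z - h)) ≤ w (coordPow p z) ^ 2)
    {ν : Measure (Fin n → ℝ)} (hν : ν = (volume.restrict (posOrthant n)).withDensity w)
    [IsFiniteMeasure ν] (hf : LocallyLipschitz f) (hf_int : Integrable f ν) :
    ν Set.univ * ∫⁻ x, ENNReal.ofReal (f x ^ 2) ∂ν ≤
      ENNReal.ofReal ((∫ x, f x ∂ν) ^ 2) +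
        ν Set.univ * ∫⁻ x, ∑ i, ENNReal.ofReal (p ^ 2 / (p - 1) * x i ^ 2) *
          ENNReal.ofReal (|partialDeriv i f x| ^ 2) ∂ν := by
  have hp₀ : 0 < p := by linarith
  have hF := measurable_coordPow (n := n) (p := p)
  have hρ_meas := aemeasurable_powDensity hp₀ hw_meas
  set ν' := volume.withDensity (powDensity p w)
  have map_eq : ν = ν'.map (coordPow p) := by rw [hν, map_coordPow_powDensity hp₀ hw_meas]
  have univ_eq : ν Set.univ = ν' Set.univ := by
    rw [map_eq, Measure.map_apply hF MeasurableSet.univ, Set.preimage_univ]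
  have : IsFiniteMeasure ν' := ⟨univ_eq ▸ measure_lt_top ν _⟩
  have key := (logConcaveAtScale_powDensity hp hw).lintegral_sq_le hρ_meas (by fun_prop)
    (hf.comp (locallyLipschitz_coordPow hp.le)) ((map_eq ▸ hf_int).comp_measurable hF)
  have ae_posOrthant : ∀ᵐ y ∂ν', y ∈ posOrthant n :=
    (ae_withDensity_iff' hρ_meas).2 (ae_of_all _ fun y => Set.mem_of_indicator_ne_zero)
  have ae_differentiable : ∀ᵐ y ∂ν', DifferentiableAt ℝ f (coordPow p y) := by
    refine ae_of_ae_map hF.aemeasurable ?_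
    rw [← map_eq, hν]
    exact ((withDensity_absolutelyContinuous _ w).trans Measure.absolutelyContinuous_restrict).ae_le
      (ae_differentiableAt_of_locallyLipschitz hf)
  have slope_eq : ∫⁻ y, ∑ i, ENNReal.ofReal
      ((y i / √(p - 1) * partialDeriv i (f ∘ coordPow p) y) ^ 2) ∂ν' = ∫⁻ x, ∑ i,
        ENNReal.ofReal (p ^ 2 / (p - 1) * x i ^ 2) *
          ENNReal.ofReal (|partialDeriv i f x| ^ 2) ∂ν := by
    have := fun i => measurable_partialDeriv hf.continuous i
    rw [map_eq, lintegral_map (by fun_prop) hF]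
    refine lintegral_congr_ae ?_
    filter_upwards [ae_posOrthant, ae_differentiable] with y hy hfy
    exact sum_ofReal_sq_partialDeriv_comp_coordPow hp hy hfy
  have f_measurable := hf.continuous.measurable
  have sq_eq : ∫⁻ y, ENNReal.ofReal ((f ∘ coordPow p) y ^ 2) ∂ν' =
      ∫⁻ x, ENNReal.ofReal (f x ^ 2) ∂ν := by
    rw [map_eq, lintegral_map (by fun_prop) hF]
    rfl
  have mean_eq : ∫ y, (f ∘ coordPow p) y ∂ν' = ∫ x, f x ∂ν := by
    rw [map_eq, integral_map hF.aemeasurable f_measurable.aestronglyMeasurable]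
    rfl
  rwa [slope_eq, sq_eq, mean_eq, ← univ_eq] at key

end CoordPow

/-! ### Reflections and the discrete cube -/

/-- The reflection of `ℝⁿ` that changes the signs of the coordinates marked by `σ`. -/
def signFlip {n : ℕ} (σ : Fin n → Bool) (x : Fin n → ℝ) : Fin n → ℝ :=
  fun i => if σ i then -x i else x i

section SignFlip

variable {n : ℕ}

theorem abs_signFlip (σ : Fin n → Bool) (x : Fin n → ℝ) (i : Fin n) :
    |signFlip σ x i| = |x i| := by
  unfold signFlip
  split_ifs <;> simp only [abs_neg]

theorem signFlip_involutive (σ : Fin n → Bool) : Function.Involutive (signFlip σ) := by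
  intro x
  ext i
  unfold signFlip
  split_ifs <;> simp only [neg_neg]

theorem signFlip_update_of_eq_zero (σ : Fin n → Bool) {i : Fin n} (b : Bool) {x : Fin n → ℝ}
    (hx : x i = 0) : signFlip (Function.update σ i b) x = signFlip σ x := by
  ext k
  rcases eq_or_ne k i with rfl | h
  · simp [signFlip, hx]
  · simp [signFlip, Function.update_of_ne h]

theorem lipschitzWith_signFlip (σ : Fin n → Bool) : LipschitzWith 1 (signFlip σ) := by
  refine LipschitzWith.of_dist_le_mul fun x y => ?_
  rw [NNReal.coe_one, one_mul]
  refine (dist_pi_le_iff dist_nonneg).2 fun i => le_trans (le_of_eq ?_) (dist_le_pi_dist x y i)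
  unfold signFlip
  split_ifs
  · exact dist_neg_neg _ _
  · rfl

theorem measurable_signFlip (σ : Fin n → Bool) : Measurable (signFlip σ) :=
  (lipschitzWith_signFlip σ).continuous.measurable

theorem measurableEmbedding_signFlip (σ : Fin n → Bool) : MeasurableEmbedding (signFlip σ) :=
  (MeasurableEquiv.ofInvolutive _ (signFlip_involutive σ)
    (measurable_signFlip σ)).measurableEmbedding

theorem volume_preserving_signFlip (σ : Fin n → Bool) :
    MeasurePreserving (signFlip σ) volume volume := by
  refine volume_preserving_pi (f := fun i (t : ℝ) => if σ i then -t else t) fun i => ?_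
  split_ifs
  · exact Measure.measurePreserving_neg volume
  · exact MeasurePreserving.id volume

theorem Unconditional.apply_signFlip {β : Type*} {g : (Fin n → ℝ) → β} (hg : Unconditional g)
    (σ : Fin n → Bool) (x : Fin n → ℝ) : g (signFlip σ x) = g x := by
  rw [hg (signFlip σ x), hg x]
  simp only [abs_signFlip]

theorem Unconditional.measurePreserving_signFlip {w : (Fin n → ℝ) → ℝ≥0∞} (hw : Unconditional w)
    (σ : Fin n → Bool) :
    MeasurePreserving (signFlip σ) (volume.withDensity w) (volume.withDensity w) := by
  refine ⟨measurable_signFlip σ, Measure.ext fun s hs => ?_⟩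
  rw [Measure.map_apply (measurable_signFlip σ) hs, withDensity_apply _ (measurable_signFlip σ hs),
    withDensity_apply _ hs, ← (volume_preserving_signFlip σ).setLIntegral_comp_preimage_emb
      (measurableEmbedding_signFlip σ) w s]
  simp only [hw.apply_signFlip]

theorem measurableSet_preimage_signFlip (σ : Fin n → Bool) :
    MeasurableSet (signFlip σ ⁻¹' posOrthant n) :=
  measurable_signFlip σ (measurableSet_posOrthant n)

theorem pairwise_disjoint_preimage_signFlip :
    Pairwise (Function.onFun Disjoint fun σ : Fin n → Bool => signFlip σ ⁻¹' posOrthant n) := by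
  intro σ τ hne
  refine Set.disjoint_left.2 fun x hσ hτ => hne (funext fun i => ?_)
  have hσi := hσ i
  have hτi := hτ i
  unfold signFlip at hσi hτi
  grind

theorem iUnion_preimage_signFlip_ae_eq {μ : Measure (Fin n → ℝ)} (hμ : μ ≪ volume) :
    (⋃ σ : Fin n → Bool, signFlip σ ⁻¹' posOrthant n) =ᵐ[μ] Set.univ := by
  have ae_ne_zero : ∀ᵐ x ∂μ, ∀ i, x i ≠ 0 := ae_all_iff.2 fun i => hμ.ae_le <| by
    rw [volume_pi]
    exact Measure.ae_eval_ne _ i 0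
  refine eventuallyEq_univ.2 ?_
  filter_upwards [ae_ne_zero] with x hx
  refine Set.mem_iUnion.2 ⟨fun i => decide (x i < 0), fun i => ?_⟩
  have := hx i
  unfold signFlip
  grind

variable {μ : Measure (Fin n → ℝ)}

theorem lintegral_eq_sum_signFlip (hac : μ ≪ volume)
    (hμ : ∀ σ, MeasurePreserving (signFlip σ) μ μ) (F : (Fin n → ℝ) → ℝ≥0∞) :
    ∫⁻ x, F x ∂μ = ∑ σ : Fin n → Bool, ∫⁻ x in posOrthant n, F (signFlip σ x) ∂μ := by
  rw [← setLIntegral_univ, ← setLIntegral_congr (iUnion_preimage_signFlip_ae_eq hac),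
    lintegral_iUnion measurableSet_preimage_signFlip pairwise_disjoint_preimage_signFlip,
    tsum_fintype]
  refine Finset.sum_congr rfl fun σ _ => ?_
  have := (hμ σ).setLIntegral_comp_preimage_emb (measurableEmbedding_signFlip σ)
    (fun x => F (signFlip σ x)) (posOrthant n)
  simpa only [signFlip_involutive σ _] using this

theorem integral_eq_sum_signFlip (hac : μ ≪ volume)
    (hμ : ∀ σ, MeasurePreserving (signFlip σ) μ μ) {f : (Fin n → ℝ) → ℝ} (hf : Integrable f μ) :
    ∫ x, f x ∂μ = ∑ σ : Fin n → Bool, ∫ x in posOrthant n, f (signFlip σ x) ∂μ := by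
  rw [← setIntegral_univ, ← setIntegral_congr_set (iUnion_preimage_signFlip_ae_eq hac),
    integral_iUnion_fintype measurableSet_preimage_signFlip pairwise_disjoint_preimage_signFlip
      fun σ => hf.integrableOn]
  refine Finset.sum_congr rfl fun σ _ => ?_
  have := (hμ σ).setIntegral_preimage_emb (measurableEmbedding_signFlip σ)
    (fun x => f (signFlip σ x)) (posOrthant n)
  simpa only [signFlip_involutive σ _] using this

theorem Unconditional.lintegral_eq {F : (Fin n → ℝ) → ℝ≥0∞} (hF : Unconditional F)
    (hac : μ ≪ volume) (hμ : ∀ σ, MeasurePreserving (signFlip σ) μ μ) :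
    ∫⁻ x, F x ∂μ = 2 ^ n * ∫⁻ x in posOrthant n, F x ∂μ := by
  simp [lintegral_eq_sum_signFlip hac hμ, hF.apply_signFlip]

theorem two_pow_mul_measure_posOrthant [IsProbabilityMeasure μ] (hac : μ ≪ volume)
    (hμ : ∀ σ, MeasurePreserving (signFlip σ) μ μ) : 2 ^ n * μ (posOrthant n) = 1 := by
  have const_unconditional : Unconditional fun _ : Fin n → ℝ => (1 : ℝ≥0∞) := fun _ => rfl
  simpa using (const_unconditional.lintegral_eq hac hμ).symm

theorem secondMoment_eq_two_pow_mul (hac : μ ≪ volume)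
    (hμ : ∀ σ, MeasurePreserving (signFlip σ) μ μ) (i : Fin n) :
    secondMoment μ i = 2 ^ n * secondMoment (μ.restrict (posOrthant n)) i := by
  have sq_unconditional : Unconditional fun x : Fin n → ℝ => ENNReal.ofReal (x i ^ 2) :=
    fun x => congrArg ENNReal.ofReal (sq_abs (x i)).symm
  exact sq_unconditional.lintegral_eq hac hμ

theorem lineDeriv_comp_signFlip (f : (Fin n → ℝ) → ℝ) (σ : Fin n → Bool) (x v : Fin n → ℝ) :
    lineDeriv ℝ (f ∘ signFlip σ) x v = lineDeriv ℝ f (signFlip σ x) (signFlip σ v) := by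
  have signFlip_linear : ∀ t : ℝ, signFlip σ (x + t • v) = signFlip σ x + t • signFlip σ v := by
    intro t
    ext i
    simp only [signFlip, Pi.add_apply, Pi.smul_apply, smul_eq_mul]
    split_ifs <;> ring
  simp only [lineDeriv, Function.comp_apply, signFlip_linear]

theorem abs_partialDeriv_comp_signFlip (f : (Fin n → ℝ) → ℝ) (σ : Fin n → Bool) (i : Fin n)
    (x : Fin n → ℝ) :
    |partialDeriv i (f ∘ signFlip σ) x| = |partialDeriv i f (signFlip σ x)| := by
  have signFlip_single : signFlip σ (Pi.single i 1) =
      if σ i then -Pi.single i (1 : ℝ) else Pi.single i 1 := by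
    ext k
    rcases eq_or_ne k i with rfl | h
    · split_ifs with hσ <;> simp [signFlip, hσ]
    · split_ifs <;> simp [signFlip, h]
  rw [partialDeriv, partialDeriv, lineDeriv_comp_signFlip, signFlip_single]
  split_ifs
  · rw [lineDeriv_neg, abs_neg]
  · rfl

end SignFlip

theorem sum_sq_le_discreteCube : ∀ (n : ℕ) (a : (Fin n → Bool) → ℝ),
    2 ^ n * ∑ σ, a σ ^ 2 ≤ (∑ σ, a σ) ^ 2 +
      2 ^ n * (1 / 4 * ∑ σ, ∑ i, (a σ - a (Function.update σ i (!σ i))) ^ 2)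
  | 0, a => by
    simp
  | n + 1, a => by
    have sum_eq_sum_faces : ∀ F : (Fin (n + 1) → Bool) → ℝ,
        ∑ σ, F σ = ∑ τ, F (Fin.cons false τ) + ∑ τ, F (Fin.cons true τ) := by
      intro F
      rw [← (Fin.consEquiv fun _ : Fin (n + 1) => Bool).sum_comp, Fintype.sum_prod_type,
        Fintype.sum_bool, add_comm]
      rfl
    have face_false := sum_sq_le_discreteCube n fun τ => a (Fin.cons false τ)
    have face_true := sum_sq_le_discreteCube n fun τ => a (Fin.cons true τ)
    simp only [sum_eq_sum_faces, Fin.sum_univ_succ, Fin.cons_zero, Fin.cons_succ,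
      Fin.update_cons_zero, ← Fin.cons_update, Bool.not_false, Bool.not_true,
      Finset.sum_add_distrib]
    set A₀ := ∑ τ, a (Fin.cons false τ)
    set A₁ := ∑ τ, a (Fin.cons true τ)
    have faces_close : (A₀ - A₁) ^ 2 ≤
        2 ^ n * ∑ τ, (a (Fin.cons false τ) - a (Fin.cons true τ)) ^ 2 := by
      rw [← Finset.sum_sub_distrib]
      simpa using sq_sum_le_card_mul_sum_sq (s := Finset.univ)
        (f := fun τ : Fin n → Bool => a (Fin.cons false τ) - a (Fin.cons true τ))
    have swap_faces : ∑ τ : Fin n → Bool, (a (Fin.cons true τ) - a (Fin.cons false τ)) ^ 2 =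
        ∑ τ : Fin n → Bool, (a (Fin.cons false τ) - a (Fin.cons true τ)) ^ 2 :=
      Finset.sum_congr rfl fun τ _ => sub_sq_comm _ _
    rw [swap_faces, pow_succ]
    nlinarith

/-! ### A Hardy-type inequality for decreasing densities -/

section CoordinateUpdate

variable {n : ℕ}

theorem lipschitzWith_update (x : Fin n → ℝ) (i : Fin n) :
    LipschitzWith 1 fun t : ℝ => Function.update x i t := by
  refine LipschitzWith.of_dist_le_mul fun s t => ?_
  rw [NNReal.coe_one, one_mul]
  refine (dist_pi_le_iff dist_nonneg).2 fun k => ?_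
  rcases eq_or_ne k i with rfl | h
  · simp
  · simp [Function.update_of_ne h, dist_nonneg]

theorem deriv_comp_update (f : (Fin n → ℝ) → ℝ) (x : Fin n → ℝ) (i : Fin n) (t : ℝ) :
    deriv (fun s => f (Function.update x i s)) t = partialDeriv i f (Function.update x i t) := by
  have update_add (s : ℝ) : Function.update x i t + s • Pi.single i 1 =
      Function.update x i (t + s) := by
    ext k
    rcases eq_or_ne k i with rfl | h
    · simp
    · simp [h]
  simp only [partialDeriv, lineDeriv, update_add]
  rw [deriv_comp_const_add (f := fun s => f (Function.update x i s)) t 0, add_zero]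

theorem enorm_sub_update_zero_le {f : (Fin n → ℝ) → ℝ} (hf : LocallyLipschitz f) {x : Fin n → ℝ}
    {i : Fin n} (hx : 0 ≤ x i) :
    ‖f x - f (Function.update x i 0)‖ₑ ≤
      ∫⁻ t in Set.Ioc 0 (x i), ‖partialDeriv i f (Function.update x i t)‖ₑ := by
  have slice_lipschitz : LocallyLipschitz fun t => f (Function.update x i t) :=
    hf.comp (lipschitzWith_update x i).locallyLipschitz
  obtain ⟨K, hK⟩ := slice_lipschitz.locallyLipschitzOn.exists_lipschitzOnWith_of_compact
    (isCompact_uIcc (a := 0) (b := x i))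
  have integral_deriv_eq := hK.absolutelyContinuousOnInterval.integral_deriv_eq_sub
  simp only [Function.update_eq_self, deriv_comp_update] at integral_deriv_eq
  rw [← integral_deriv_eq, intervalIntegral.integral_of_le hx]
  exact enorm_integral_le_lintegral_enorm _

theorem measurable_setLIntegral_update (i : Fin n) {g : (Fin n → ℝ) → ℝ≥0∞} (hg : Measurable g) :
    Measurable fun x : Fin n → ℝ => ∫⁻ t in Set.Ioc 0 (x i), g (Function.update x i t) := by
  have update_measurable : Measurable fun q : (Fin n → ℝ) × ℝ => Function.update q.1 i q.2 := by
    refine measurable_pi_iff.2 fun k => ?_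
    rcases eq_or_ne k i with rfl | h
    · simpa using measurable_snd
    · simp only [Function.update_of_ne h]
      fun_prop
  have triangle_measurable : MeasurableSet {q : (Fin n → ℝ) × ℝ | q.2 ∈ Set.Ioc 0 (q.1 i)} :=
    (measurableSet_lt measurable_const measurable_snd).inter
      (measurableSet_le measurable_snd (by fun_prop))
  simp only [← lintegral_indicator measurableSet_Ioc]
  exact ((hg.comp update_measurable).indicator triangle_measurable).lintegral_prod_right'
    (ν := volume)

end CoordinateUpdate

theorem sq_lintegral_le_of_sq_le_mul {X : Type*} [MeasurableSpace X] {μ : Measure X}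
    {H A B : X → ℝ≥0∞} (hA : AEMeasurable A μ) (hB : AEMeasurable B μ)
    (h : ∀ᵐ x ∂μ, H x ^ 2 ≤ A x * B x) :
    (∫⁻ x, H x ∂μ) ^ 2 ≤ (∫⁻ x, A x ∂μ) * ∫⁻ x, B x ∂μ := by
  have le_geometric_mean : ∀ᵐ x ∂μ, H x ≤ A x ^ (2 : ℝ)⁻¹ * B x ^ (2 : ℝ)⁻¹ := by
    filter_upwards [h] with x hx
    rwa [← ENNReal.mul_rpow_of_nonneg _ _ (by norm_num), ENNReal.le_rpow_inv_iff two_pos,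
      ENNReal.rpow_two]
  have holder := ENNReal.lintegral_mul_le_Lp_mul_Lq μ Real.HolderConjugate.two_two
    (hA.pow_const (2 : ℝ)⁻¹) (hB.pow_const (2 : ℝ)⁻¹)
  simp only [ENNReal.rpow_inv_rpow two_ne_zero, one_div] at holder
  calc (∫⁻ x, H x ∂μ) ^ 2
      ≤ ((∫⁻ x, A x ∂μ) ^ (2 : ℝ)⁻¹ * (∫⁻ x, B x ∂μ) ^ (2 : ℝ)⁻¹) ^ 2 := by
        gcongr
        exact (lintegral_mono_ae le_geometric_mean).trans holder
    _ = (∫⁻ x, A x ∂μ) * ∫⁻ x, B x ∂μ := by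
        rw [← ENNReal.mul_rpow_of_nonneg _ _ (by norm_num), ← ENNReal.rpow_two,
          ENNReal.rpow_inv_rpow two_ne_zero]

section Triangle

variable {α : Type*} [LinearOrder α] [TopologicalSpace α] [OrderClosedTopology α]
  [SecondCountableTopology α] [MeasurableSpace α] [BorelSpace α] {μ ν : Measure α} [SFinite μ]
  [SFinite ν]

theorem lintegral_setLIntegral_Iic_swap {F : α → α → ℝ≥0∞}
    (hF : AEMeasurable (Function.uncurry F) (μ.prod ν)) :
    ∫⁻ x, ∫⁻ t in Set.Iic x, F x t ∂ν ∂μ = ∫⁻ t, ∫⁻ x in Set.Ici t, F x t ∂μ ∂ν := by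
  have triangle_measurable : MeasurableSet {q : α × α | q.2 ≤ q.1} :=
    measurableSet_le measurable_snd measurable_fst
  simp only [← lintegral_indicator measurableSet_Iic, ← lintegral_indicator measurableSet_Ici]
  exact lintegral_lintegral_swap (hF.indicator triangle_measurable)

theorem sq_lintegral_le_two_mul_setLIntegral_Iic {ρ : α → ℝ≥0∞} (hρ : AEMeasurable ρ μ) :
    (∫⁻ x, ρ x ∂μ) ^ 2 ≤ 2 * ∫⁻ x, ρ x * ∫⁻ y in Set.Iic x, ρ y ∂μ ∂μ := by
  have Iic_measurable : Measurable fun x => ∫⁻ y in Set.Iic x, ρ y ∂μ :=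
    Monotone.measurable fun x y hxy => lintegral_mono_set (Set.Iic_subset_Iic.2 hxy)
  have Ici_eq_Iic : ∫⁻ x, ρ x * ∫⁻ y in Set.Ici x, ρ y ∂μ ∂μ =
      ∫⁻ x, ρ x * ∫⁻ y in Set.Iic x, ρ y ∂μ ∂μ := by
    simp only [← lintegral_const_mul'' _ hρ.restrict]
    rw [lintegral_setLIntegral_Iic_swap (hρ.comp_fst.mul hρ.comp_snd)]
    simp only [mul_comm]
  have Iic_aemeasurable : AEMeasurable (fun x => ρ x * ∫⁻ y in Set.Iic x, ρ y ∂μ) μ :=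
    hρ.mul Iic_measurable.aemeasurable
  calc (∫⁻ x, ρ x ∂μ) ^ 2 = ∫⁻ x, ρ x * ∫⁻ y, ρ y ∂μ ∂μ := by
        rw [lintegral_mul_const'' _ hρ, sq]
    _ ≤ ∫⁻ x, (ρ x * ∫⁻ y in Set.Iic x, ρ y ∂μ + ρ x * ∫⁻ y in Set.Ici x, ρ y ∂μ) ∂μ := by
        refine lintegral_mono fun x => ?_
        rw [← mul_add]
        gcongr
        rw [← setLIntegral_univ, ← Set.Iic_union_Ici (a := x)]
        exact lintegral_union_le _ _ _
    _ = 2 * ∫⁻ x, ρ x * ∫⁻ y in Set.Iic x, ρ y ∂μ ∂μ := by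
        rw [lintegral_add_left' Iic_aemeasurable, Ici_eq_Iic, two_mul]

end Triangle

section HardyHalfLine

variable {ρ g : ℝ → ℝ≥0∞}

theorem sq_setLIntegral_Ici_le {t : ℝ} (hρ : AntitoneOn ρ (Set.Ici t)) :
    (∫⁻ x in Set.Ici t, ρ x) ^ 2 ≤
      ρ t * ∫⁻ x in Set.Ici t, 2 * ENNReal.ofReal (x - t) * ρ x := by
  have hρ_meas : AEMeasurable ρ (volume.restrict (Set.Ici t)) :=
    aemeasurable_restrict_of_antitoneOn measurableSet_Ici hρ
  have truncated_le (x : ℝ) : ∫⁻ y in Set.Iic x, ρ y ∂volume.restrict (Set.Ici t) ≤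
      ρ t * ENNReal.ofReal (x - t) := by
    rw [Measure.restrict_restrict measurableSet_Iic, Set.inter_comm, Set.Ici_inter_Iic,
      ← Real.volume_Icc, ← setLIntegral_const]
    exact setLIntegral_mono' measurableSet_Icc fun y hy => hρ Set.self_mem_Ici hy.1 hy.1
  calc (∫⁻ x in Set.Ici t, ρ x) ^ 2
      ≤ 2 * ∫⁻ x in Set.Ici t, ρ x * ∫⁻ y in Set.Iic x, ρ y ∂volume.restrict (Set.Ici t) :=
        sq_lintegral_le_two_mul_setLIntegral_Iic hρ_meas
    _ ≤ 2 * ∫⁻ x in Set.Ici t, ρ x * (ρ t * ENNReal.ofReal (x - t)) := by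
        gcongr with x
        exact truncated_le x
    _ = ρ t * ∫⁻ x in Set.Ici t, 2 * ENNReal.ofReal (x - t) * ρ x := by
        rw [← lintegral_const_mul'' _ (by fun_prop), ← lintegral_const_mul'' _ (by fun_prop)]
        refine lintegral_congr fun x => ?_
        ring

theorem setLIntegral_Ioi_Ioc_swap {F : ℝ → ℝ → ℝ≥0∞} (hF : AEMeasurable (Function.uncurry F)
      ((volume.restrict (Set.Ioi 0)).prod (volume.restrict (Set.Ioi 0)))) :
    ∫⁻ x in Set.Ioi 0, ∫⁻ t in Set.Ioc 0 x, F x t =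
      ∫⁻ t in Set.Ioi 0, ∫⁻ x in Set.Ici t, F x t := by
  have swap := lintegral_setLIntegral_Iic_swap hF
  simp only [Measure.restrict_restrict measurableSet_Iic, Set.Iic_inter_Ioi] at swap
  rw [swap]
  refine setLIntegral_congr_fun measurableSet_Ioi fun t ht => ?_
  rw [Measure.restrict_restrict measurableSet_Ici,
    Set.inter_eq_left.2 (Set.Ici_subset_Ioi.2 ht)]

theorem setLIntegral_Ioc_two_mul_sub {x : ℝ} (hx : 0 ≤ x) :
    ∫⁻ t in Set.Ioc 0 x, 2 * ENNReal.ofReal (x - t) = ENNReal.ofReal (x ^ 2) := by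
  have sub_nonneg : 0 ≤ᵐ[volume.restrict (Set.Ioc 0 x)] fun t => x - t := by
    filter_upwards [ae_restrict_mem measurableSet_Ioc] with t ht
    exact sub_nonneg.2 ht.2
  have integral_sub : ∫ t in Set.Ioc 0 x, (x - t) = x ^ 2 / 2 := by
    rw [← intervalIntegral.integral_of_le hx, intervalIntegral.integral_sub (by simp) (by simp),
      intervalIntegral.integral_const, integral_id, smul_eq_mul]
    ring
  rw [lintegral_const_mul _ (by fun_prop), ← ofReal_integral_eq_lintegral_ofReal
    (by fun_prop : Continuous fun t : ℝ => x - t).integrableOn_Ioc sub_nonneg, integral_sub,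
    ← ENNReal.ofReal_ofNat 2, ← ENNReal.ofReal_mul zero_le_two, mul_div_cancel₀ _ two_ne_zero]

theorem setLIntegral_Ioi_Ici_two_mul_sub_mul (hρ : AEMeasurable ρ (volume.restrict (Set.Ioi 0))) :
    ∫⁻ t in Set.Ioi 0, ∫⁻ x in Set.Ici t, 2 * ENNReal.ofReal (x - t) * ρ x =
      ∫⁻ x in Set.Ioi 0, ENNReal.ofReal (x ^ 2) * ρ x := by
  have weight_measurable : Measurable fun q : ℝ × ℝ => 2 * ENNReal.ofReal (q.1 - q.2) := by
    fun_prop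
  rw [← setLIntegral_Ioi_Ioc_swap (F := fun x t => 2 * ENNReal.ofReal (x - t) * ρ x)
    (weight_measurable.aemeasurable.mul hρ.comp_fst)]
  refine setLIntegral_congr_fun measurableSet_Ioi fun x hx => ?_
  rw [lintegral_mul_const _ (by fun_prop), setLIntegral_Ioc_two_mul_sub (le_of_lt hx)]

theorem sq_setLIntegral_primitive_mul_le (hρ : AntitoneOn ρ (Set.Ioi 0)) (hg : Measurable g) :
    (∫⁻ x in Set.Ioi 0, (∫⁻ t in Set.Ioc 0 x, g t) * ρ x) ^ 2 ≤
      (∫⁻ x in Set.Ioi 0, g x ^ 2 * ρ x) * ∫⁻ x in Set.Ioi 0, ENNReal.ofReal (x ^ 2) * ρ x := by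
  have hρ_meas : AEMeasurable ρ (volume.restrict (Set.Ioi 0)) :=
    aemeasurable_restrict_of_antitoneOn measurableSet_Ioi hρ
  have primitive_eq_tail : ∫⁻ x in Set.Ioi 0, (∫⁻ t in Set.Ioc 0 x, g t) * ρ x =
      ∫⁻ t in Set.Ioi 0, g t * ∫⁻ x in Set.Ici t, ρ x := by
    simp only [← lintegral_mul_const _ hg]
    rw [setLIntegral_Ioi_Ioc_swap (F := fun x t => g t * ρ x)
      (hg.aemeasurable.comp_snd.mul hρ_meas.comp_fst)]
    refine setLIntegral_congr_fun measurableSet_Ioi fun t ht => ?_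
    exact lintegral_const_mul'' _ (hρ_meas.mono_set (Set.Ici_subset_Ioi.2 ht))
  rw [primitive_eq_tail, ← setLIntegral_Ioi_Ici_two_mul_sub_mul hρ_meas]
  have tail_antitone : Antitone fun t => ∫⁻ x in Set.Ici t, 2 * ENNReal.ofReal (x - t) * ρ x :=
    fun s t hst => lintegral_mono' (Measure.restrict_mono (Set.Ici_subset_Ici.2 hst) le_rfl)
      fun x => by gcongr
  refine sq_lintegral_le_of_sq_le_mul (by fun_prop) tail_antitone.measurable.aemeasurable ?_
  filter_upwards [ae_restrict_mem measurableSet_Ioi] with t ht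
  rw [mul_pow, mul_assoc]
  gcongr
  exact sq_setLIntegral_Ici_le (hρ.mono (Set.Ici_subset_Ioi.2 ht))

end HardyHalfLine

theorem lintegral_pi_eq_lintegral_insertNth {n : ℕ} {X : Fin (n + 1) → Type*}
    [∀ i, MeasurableSpace (X i)] (μ : ∀ i, Measure (X i)) [∀ i, SigmaFinite (μ i)]
    (i : Fin (n + 1)) {F : (∀ i, X i) → ℝ≥0∞} (hF : AEMeasurable F (Measure.pi μ)) :
    ∫⁻ x, F x ∂(Measure.pi μ) =
      ∫⁻ y, ∫⁻ t, F (i.insertNth t y) ∂μ i ∂(Measure.pi fun k => μ (i.succAbove k)) := by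
  have preserving := (measurePreserving_piFinSuccAbove μ i).symm
  rw [← preserving.lintegral_comp_emb (MeasurableEquiv.measurableEmbedding _), lintegral_prod_symm]
  · rfl
  · exact hF.comp_quasiMeasurePreserving preserving.quasiMeasurePreserving

theorem aemeasurable_lintegral_insertNth {n : ℕ} {X : Fin (n + 1) → Type*}
    [∀ i, MeasurableSpace (X i)] (μ : ∀ i, Measure (X i)) [∀ i, SigmaFinite (μ i)]
    (i : Fin (n + 1)) {F : (∀ i, X i) → ℝ≥0∞} (hF : AEMeasurable F (Measure.pi μ)) :
    AEMeasurable (fun y => ∫⁻ t, F (i.insertNth t y) ∂μ i)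
      (Measure.pi fun k => μ (i.succAbove k)) := by
  have preserving := (measurePreserving_piFinSuccAbove μ i).symm
  exact (hF.comp_quasiMeasurePreserving preserving.quasiMeasurePreserving).lintegral_prod_left'

theorem restrict_posOrthant (n : ℕ) : (volume : Measure (Fin n → ℝ)).restrict (posOrthant n) =
    Measure.pi fun _ => volume.restrict (Set.Ioi 0) := by
  rw [← Measure.restrict_pi_pi, volume_pi]
  congr 1
  ext x
  simp [posOrthant]

theorem sq_setLIntegral_posOrthant_primitive_mul_le {n : ℕ} (i : Fin n) {w g : (Fin n → ℝ) → ℝ≥0∞}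
    (hw : AEMeasurable w (volume.restrict (posOrthant n))) (hw_anti : AntitoneOn w (posOrthant n))
    (hg : Measurable g) :
    (∫⁻ x in posOrthant n, (∫⁻ t in Set.Ioc 0 (x i), g (Function.update x i t)) * w x) ^ 2 ≤
      (∫⁻ x in posOrthant n, g x ^ 2 * w x) *
        ∫⁻ x in posOrthant n, ENNReal.ofReal (x i ^ 2) * w x := by
  obtain _ | n := n
  · exact i.elim0
  have ae_mem : ∀ᵐ y ∂Measure.pi fun _ : Fin n => (volume : Measure ℝ).restrict (Set.Ioi 0),
      y ∈ posOrthant n :=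
    restrict_posOrthant n ▸ ae_restrict_mem (measurableSet_posOrthant n)
  rw [restrict_posOrthant] at hw ⊢
  have primitive_meas := (measurable_setLIntegral_update i hg).aemeasurable.mul hw
  have slope_meas := (hg.pow_const 2).aemeasurable.mul hw
  have moment_meas :=
    ((measurable_pi_apply i).pow_const 2).ennreal_ofReal.aemeasurable.mul hw
  have slice := fun {F : (Fin (n + 1) → ℝ) → ℝ≥0∞} =>
    lintegral_pi_eq_lintegral_insertNth (F := F) (fun _ => volume.restrict (Set.Ioi 0)) i
  refine (congrArg (· ^ 2) (slice primitive_meas)).trans_le ?_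
  refine le_of_le_of_eq ?_ (congrArg₂ (· * ·) (slice slope_meas) (slice moment_meas)).symm
  refine sq_lintegral_le_of_sq_le_mul (aemeasurable_lintegral_insertNth _ i slope_meas)
    (aemeasurable_lintegral_insertNth _ i moment_meas) ?_
  filter_upwards [ae_mem] with y hy
  have insert_mem {t : ℝ} (ht : t ∈ Set.Ioi 0) : i.insertNth t y ∈ posOrthant (n + 1) :=
    i.forall_iff_succAbove.2 ⟨by simpa using ht, fun k => by simpa using hy k⟩
  have slice_antitone : AntitoneOn (fun t => w (i.insertNth t y)) (Set.Ioi 0) :=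
    fun s hs t ht hst => hw_anti (insert_mem hs) (insert_mem ht)
      (i.forall_iff_succAbove.2 ⟨by simpa using hst, fun k => by simp⟩)
  have insert_measurable : Measurable fun t : ℝ => (i.insertNth t y : Fin (n + 1) → ℝ) :=
    (MeasurableEquiv.piFinSuccAbove (fun _ : Fin (n + 1) => ℝ) i).symm.measurable.comp
      measurable_prodMk_right
  simpa only [Fin.insertNth_apply_same, Fin.update_insertNth, Pi.mul_apply,
    Function.comp_apply] using
    sq_setLIntegral_primitive_mul_le slice_antitone (hg.comp insert_measurable)

/-! ### Comparison of the orthants -/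

theorem ofReal_sq_eq_enorm_sq (a : ℝ) : ENNReal.ofReal (a ^ 2) = ‖a‖ₑ ^ 2 := by
  rw [← Real.enorm_of_nonneg (sq_nonneg a), enorm_pow]

theorem ennreal_add_sq_le (a b : ℝ≥0∞) : (a + b) ^ 2 ≤ 2 * (a ^ 2 + b ^ 2) := by
  have := ENNReal.rpow_add_le_mul_rpow_add_rpow a b one_le_two
  norm_num at this
  exact_mod_cast this

section Orthants

variable {n : ℕ} {w : (Fin n → ℝ) → ℝ≥0∞}

theorem enorm_sub_le_of_eq_on_face {f g : (Fin n → ℝ) → ℝ} (hf : LocallyLipschitz f)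
    (hg : LocallyLipschitz g) {x : Fin n → ℝ} {i : Fin n} (hx : 0 ≤ x i)
    (hfg : f (Function.update x i 0) = g (Function.update x i 0)) :
    ‖f x - g x‖ₑ ≤ ∫⁻ t in Set.Ioc 0 (x i), (‖partialDeriv i f (Function.update x i t)‖ₑ +
      ‖partialDeriv i g (Function.update x i t)‖ₑ) := by
  have slope_measurable : Measurable fun t => ‖partialDeriv i f (Function.update x i t)‖ₑ :=
    ((measurable_partialDeriv hf.continuous i).comp
      (lipschitzWith_update x i).continuous.measurable).enorm
  rw [lintegral_add_left slope_measurable]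
  calc ‖f x - g x‖ₑ
      = ‖(f x - f (Function.update x i 0)) - (g x - g (Function.update x i 0))‖ₑ := by
        rw [hfg, sub_sub_sub_cancel_right]
    _ ≤ ‖f x - f (Function.update x i 0)‖ₑ + ‖g x - g (Function.update x i 0)‖ₑ := enorm_sub_le
    _ ≤ _ := add_le_add (enorm_sub_update_zero_le hf hx) (enorm_sub_update_zero_le hg hx)

theorem sq_lintegral_primitive_le {ν : Measure (Fin n → ℝ)}
    (hw : AEMeasurable w (volume.restrict (posOrthant n))) (hw_anti : AntitoneOn w (posOrthant n))
    (hν : ν = (volume.restrict (posOrthant n)).withDensity w) (i : Fin n)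
    {g : (Fin n → ℝ) → ℝ≥0∞} (hg : Measurable g) :
    (∫⁻ x, (∫⁻ t in Set.Ioc 0 (x i), g (Function.update x i t)) ∂ν) ^ 2 ≤
      (∫⁻ x, g x ^ 2 ∂ν) * secondMoment ν i := by
  have lintegral_eq {F : (Fin n → ℝ) → ℝ≥0∞} (hF : Measurable F) :
      ∫⁻ x, F x ∂ν = ∫⁻ x in posOrthant n, F x * w x := by
    rw [hν, lintegral_withDensity_eq_lintegral_mul₀ hw hF.aemeasurable]
    simp only [Pi.mul_apply, mul_comm]
  rw [secondMoment, lintegral_eq (measurable_setLIntegral_update i hg),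
    lintegral_eq (hg.pow_const 2), lintegral_eq (by fun_prop)]
  exact sq_setLIntegral_posOrthant_primitive_mul_le i hw hw_anti hg

theorem enorm_integral_sub_sq_le_of_eq_on_face {ν : Measure (Fin n → ℝ)}
    (hw : AEMeasurable w (volume.restrict (posOrthant n))) (hw_anti : AntitoneOn w (posOrthant n))
    (hν : ν = (volume.restrict (posOrthant n)).withDensity w) (i : Fin n)
    {f g : (Fin n → ℝ) → ℝ} (hf : LocallyLipschitz f) (hg : LocallyLipschitz g)
    (hf_int : Integrable f ν) (hg_int : Integrable g ν) (hfg : ∀ x, x i = 0 → f x = g x) :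
    ‖∫ x, f x ∂ν - ∫ x, g x ∂ν‖ₑ ^ 2 ≤
      2 * (∫⁻ x, ‖partialDeriv i f x‖ₑ ^ 2 ∂ν + ∫⁻ x, ‖partialDeriv i g x‖ₑ ^ 2 ∂ν) *
        secondMoment ν i := by
  have hf_meas := (measurable_partialDeriv hf.continuous i).enorm
  have hg_meas := (measurable_partialDeriv hg.continuous i).enorm
  have ae_mem : ∀ᵐ x ∂ν, x ∈ posOrthant n :=
    hν ▸ (withDensity_absolutelyContinuous _ w).ae_le (ae_restrict_mem (measurableSet_posOrthant n))
  calc ‖∫ x, f x ∂ν - ∫ x, g x ∂ν‖ₑ ^ 2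
      ≤ (∫⁻ x, ‖f x - g x‖ₑ ∂ν) ^ 2 := by
        rw [← integral_sub hf_int hg_int]
        gcongr
        exact enorm_integral_le_lintegral_enorm _
    _ ≤ (∫⁻ x, (∫⁻ t in Set.Ioc 0 (x i), (‖partialDeriv i f (Function.update x i t)‖ₑ +
          ‖partialDeriv i g (Function.update x i t)‖ₑ)) ∂ν) ^ 2 := by
        gcongr 1
        refine lintegral_mono_ae ?_
        filter_upwards [ae_mem] with x hx
        exact enorm_sub_le_of_eq_on_face hf hg (hx i).le (hfg _ (Function.update_self i 0 x))
    _ ≤ (∫⁻ x, (‖partialDeriv i f x‖ₑ + ‖partialDeriv i g x‖ₑ) ^ 2 ∂ν) * secondMoment ν i :=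
        sq_lintegral_primitive_le hw hw_anti hν i (hf_meas.add hg_meas)
    _ ≤ (∫⁻ x, 2 * (‖partialDeriv i f x‖ₑ ^ 2 + ‖partialDeriv i g x‖ₑ ^ 2) ∂ν) *
          secondMoment ν i := by
        gcongr
        exact ennreal_add_sq_le _ _
    _ = _ := by
        rw [lintegral_const_mul _ (by fun_prop), lintegral_add_left (hf_meas.pow_const 2)]

/-- The integral of `f` over the orthant `signFlip σ '' posOrthant n`, pulled back to the positive
orthant; `μ` is meant to be invariant under all `signFlip σ`. -/
noncomputable def orthantIntegral (μ : Measure (Fin n → ℝ)) (f : (Fin n → ℝ) → ℝ)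
    (σ : Fin n → Bool) : ℝ :=
  ∫ x in posOrthant n, f (signFlip σ x) ∂μ

variable {μ : Measure (Fin n → ℝ)} {f : (Fin n → ℝ) → ℝ}

theorem enorm_orthantIntegral_sub_sq_le (hw : AEMeasurable w volume) (hw_unc : Unconditional w)
    (hw_anti : AntitoneOn w (posOrthant n)) (hμ : μ = volume.withDensity w)
    (hf : LocallyLipschitz f) (hf_int : Integrable f μ) (i : Fin n) (σ : Fin n → Bool) :
    ‖orthantIntegral μ f σ - orthantIntegral μ f (Function.update σ i (!σ i))‖ₑ ^ 2 ≤
      2 * (∫⁻ x in posOrthant n, ‖partialDeriv i f (signFlip σ x)‖ₑ ^ 2 ∂μ +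
        ∫⁻ x in posOrthant n,
          ‖partialDeriv i f (signFlip (Function.update σ i (!σ i)) x)‖ₑ ^ 2 ∂μ) *
        secondMoment (μ.restrict (posOrthant n)) i := by
  have comp_lipschitz (τ : Fin n → Bool) : LocallyLipschitz (f ∘ signFlip τ) :=
    hf.comp (lipschitzWith_signFlip τ).locallyLipschitz
  have comp_integrable (τ : Fin n → Bool) : IntegrableOn (f ∘ signFlip τ) (posOrthant n) μ :=
    ((hμ ▸ hw_unc.measurePreserving_signFlip τ).integrable_comp_of_integrable hf_int).integrableOn
  have enorm_sq_partialDeriv (τ : Fin n → Bool) (x : Fin n → ℝ) :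
      ‖partialDeriv i (f ∘ signFlip τ) x‖ₑ ^ 2 = ‖partialDeriv i f (signFlip τ x)‖ₑ ^ 2 := by
    rw [Real.enorm_eq_ofReal_abs, abs_partialDeriv_comp_signFlip, ← Real.enorm_eq_ofReal_abs]
  have restrict_eq : μ.restrict (posOrthant n) = (volume.restrict (posOrthant n)).withDensity w :=
    hμ ▸ restrict_withDensity (measurableSet_posOrthant n) w
  simpa only [enorm_sq_partialDeriv, orthantIntegral, Function.comp_apply] using
    enorm_integral_sub_sq_le_of_eq_on_face hw.restrict hw_anti restrict_eq i (comp_lipschitz σ)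
      (comp_lipschitz (Function.update σ i (!σ i))) (comp_integrable σ) (comp_integrable _)
      fun x hx => congrArg f (signFlip_update_of_eq_zero σ _ hx).symm

theorem sum_enorm_orthantIntegral_sub_sq_le (hw : AEMeasurable w volume) (hw_unc : Unconditional w)
    (hw_anti : AntitoneOn w (posOrthant n)) (hμ : μ = volume.withDensity w)
    (hf : LocallyLipschitz f) (hf_int : Integrable f μ) (i : Fin n) :
    ∑ σ, ‖orthantIntegral μ f σ - orthantIntegral μ f (Function.update σ i (!σ i))‖ₑ ^ 2 ≤
      4 * (secondMoment (μ.restrict (posOrthant n)) i * ∫⁻ x, ‖partialDeriv i f x‖ₑ ^ 2 ∂μ) := by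
  have hac : μ ≪ volume := hμ ▸ withDensity_absolutelyContinuous volume w
  have hpres : ∀ σ, MeasurePreserving (signFlip σ) μ μ :=
    hμ ▸ hw_unc.measurePreserving_signFlip
  have flip_bijective : Function.Bijective fun σ : Fin n → Bool => Function.update σ i (!σ i) :=
    Function.Involutive.bijective fun σ => by simp
  refine (Finset.sum_le_sum fun σ _ =>
    enorm_orthantIntegral_sub_sq_le hw hw_unc hw_anti hμ hf hf_int i σ).trans_eq ?_
  rw [← Finset.sum_mul, ← Finset.mul_sum, Finset.sum_add_distrib, flip_bijective.sum_comp fun σ =>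
      ∫⁻ x in posOrthant n, ‖partialDeriv i f (signFlip σ x)‖ₑ ^ 2 ∂μ,
    ← lintegral_eq_sum_signFlip hac hpres fun x => ‖partialDeriv i f x‖ₑ ^ 2]
  ring

theorem sum_enorm_sq_le_discreteCube {a : (Fin n → Bool) → ℝ} (ha : ∑ σ, a σ = 0) :
    4 * ∑ σ, ‖a σ‖ₑ ^ 2 ≤ ∑ σ, ∑ i, ‖a σ - a (Function.update σ i (!σ i))‖ₑ ^ 2 := by
  have poincare : 4 * ∑ σ, a σ ^ 2 ≤ ∑ σ, ∑ i, (a σ - a (Function.update σ i (!σ i))) ^ 2 := by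
    have := sum_sq_le_discreteCube n a
    rw [ha, zero_pow two_ne_zero, zero_add, mul_le_mul_iff_right₀ (by positivity)] at this
    linarith
  have := ENNReal.ofReal_le_ofReal poincare
  rw [ENNReal.ofReal_mul zero_le_four, ENNReal.ofReal_ofNat,
    ENNReal.ofReal_sum_of_nonneg (fun _ _ => by positivity),
    ENNReal.ofReal_sum_of_nonneg (fun _ _ => by positivity)] at this
  simpa only [ENNReal.ofReal_sum_of_nonneg fun _ _ => sq_nonneg _, ofReal_sq_eq_enorm_sq] using this

theorem two_pow_mul_sum_orthantIntegral_sq_le (hw : AEMeasurable w volume)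
    (hw_unc : Unconditional w) (hw_anti : AntitoneOn w (posOrthant n))
    (hμ : μ = volume.withDensity w) (hf : LocallyLipschitz f) (hf_int : Integrable f μ)
    (hf_mean : ∫ x, f x ∂μ = 0) :
    2 ^ n * ∑ σ, ENNReal.ofReal (orthantIntegral μ f σ ^ 2) ≤
      ∫⁻ x, ∑ i, secondMoment μ i * ENNReal.ofReal (|partialDeriv i f x| ^ 2) ∂μ := by
  have hac : μ ≪ volume := hμ ▸ withDensity_absolutelyContinuous volume w
  have hpres : ∀ σ, MeasurePreserving (signFlip σ) μ μ :=
    hμ ▸ hw_unc.measurePreserving_signFlip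
  have mean_eq : ∑ σ, orthantIntegral μ f σ = 0 :=
    hf_mean ▸ (integral_eq_sum_signFlip hac hpres hf_int).symm
  have slope_measurable (i : Fin n) : Measurable fun x => ‖partialDeriv i f x‖ₑ ^ 2 :=
    (measurable_partialDeriv hf.continuous i).enorm.pow_const 2
  simp only [sq_abs, ofReal_sq_eq_enorm_sq]
  rw [← ENNReal.mul_le_mul_iff_right four_ne_zero (by norm_num)]
  calc 4 * (2 ^ n * ∑ σ, ‖orthantIntegral μ f σ‖ₑ ^ 2)
      = 2 ^ n * (4 * ∑ σ, ‖orthantIntegral μ f σ‖ₑ ^ 2) := by ring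
    _ ≤ 2 ^ n * ∑ i, 4 * (secondMoment (μ.restrict (posOrthant n)) i *
          ∫⁻ x, ‖partialDeriv i f x‖ₑ ^ 2 ∂μ) := by
        gcongr 2 ^ n * ?_
        refine (sum_enorm_sq_le_discreteCube mean_eq).trans ?_
        rw [Finset.sum_comm]
        exact Finset.sum_le_sum fun i _ =>
          sum_enorm_orthantIntegral_sub_sq_le hw hw_unc hw_anti hμ hf hf_int i
    _ = 4 * ∑ i, secondMoment μ i * ∫⁻ x, ‖partialDeriv i f x‖ₑ ^ 2 ∂μ := by
        simp only [secondMoment_eq_two_pow_mul hac hpres, Finset.mul_sum]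
        exact Finset.sum_congr rfl fun i _ => by ring
    _ = 4 * ∫⁻ x, ∑ i, secondMoment μ i * ‖partialDeriv i f x‖ₑ ^ 2 ∂μ := by
        rw [lintegral_finsetSum _ fun i _ => (slope_measurable i).const_mul _]
        simp only [lintegral_const_mul _ (slope_measurable _)]

theorem Unconditional.orthantIntegral_eq_zero (hf : Unconditional f) (hac : μ ≪ volume)
    (hμ : ∀ σ, MeasurePreserving (signFlip σ) μ μ) (hf_int : Integrable f μ)
    (hf_mean : ∫ x, f x ∂μ = 0) (σ : Fin n → Bool) : orthantIntegral μ f σ = 0 := by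
  simpa [integral_eq_sum_signFlip hac hμ hf_int, orthantIntegral, hf.apply_signFlip] using hf_mean

theorem lintegral_sq_le_sum_orthantIntegral {p : ℝ} (hp : 1 < p) (hw : AEMeasurable w volume)
    (hw_unc : Unconditional w)
    (hw_mid : ∀ z h, z + h ∈ posOrthant n → z - h ∈ posOrthant n →
      w (coordPow p (z + h)) * w (coordPow p (z - h)) ≤ w (coordPow p z) ^ 2)
    (hμ : μ = volume.withDensity w) [IsProbabilityMeasure μ] (hf : LocallyLipschitz f)
    (hf_int : Integrable f μ) :
    ∫⁻ x, ENNReal.ofReal (f x ^ 2) ∂μ ≤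
      2 ^ n * ∑ σ, ENNReal.ofReal (orthantIntegral μ f σ ^ 2) +
        ∫⁻ x, ∑ i, ENNReal.ofReal (p ^ 2 / (p - 1) * x i ^ 2) *
          ENNReal.ofReal (|partialDeriv i f x| ^ 2) ∂μ := by
  have hac : μ ≪ volume := hμ ▸ withDensity_absolutelyContinuous volume w
  have hpres : ∀ σ, MeasurePreserving (signFlip σ) μ μ :=
    hμ ▸ hw_unc.measurePreserving_signFlip
  have restrict_eq : μ.restrict (posOrthant n) = (volume.restrict (posOrthant n)).withDensity w :=
    hμ ▸ restrict_withDensity (measurableSet_posOrthant n) w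
  set energy : (Fin n → ℝ) → ℝ≥0∞ := fun x => ∑ i,
    ENNReal.ofReal (p ^ 2 / (p - 1) * x i ^ 2) * ENNReal.ofReal (|partialDeriv i f x| ^ 2)
  have orthant_le (σ : Fin n → Bool) :
      μ (posOrthant n) * ∫⁻ x in posOrthant n, ENNReal.ofReal (f (signFlip σ x) ^ 2) ∂μ ≤
        ENNReal.ofReal (orthantIntegral μ f σ ^ 2) +
          μ (posOrthant n) * ∫⁻ x in posOrthant n, energy (signFlip σ x) ∂μ := by
    have := lintegral_sq_le_posOrthant hp hw.restrict hw_mid restrict_eq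
      (hf.comp (lipschitzWith_signFlip σ).locallyLipschitz)
      ((hpres σ).integrable_comp_of_integrable hf_int).restrict
    have sq_signFlip (x : Fin n → ℝ) (i : Fin n) : signFlip σ x i ^ 2 = x i ^ 2 :=
      sq_eq_sq_iff_abs_eq_abs _ _ |>.2 (abs_signFlip σ x i)
    simpa only [energy, sq_signFlip, abs_partialDeriv_comp_signFlip, orthantIntegral,
      Function.comp_apply, Measure.restrict_apply_univ] using this
  calc ∫⁻ x, ENNReal.ofReal (f x ^ 2) ∂μ
      = 2 ^ n * ∑ σ, μ (posOrthant n) *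
          ∫⁻ x in posOrthant n, ENNReal.ofReal (f (signFlip σ x) ^ 2) ∂μ := by
        rw [← Finset.mul_sum,
          ← lintegral_eq_sum_signFlip hac hpres fun x => ENNReal.ofReal (f x ^ 2),
          ← mul_assoc, two_pow_mul_measure_posOrthant hac hpres, one_mul]
    _ ≤ 2 ^ n * ∑ σ, (ENNReal.ofReal (orthantIntegral μ f σ ^ 2) +
          μ (posOrthant n) * ∫⁻ x in posOrthant n, energy (signFlip σ x) ∂μ) := by
        gcongr with σ
        exact orthant_le σ
    _ = 2 ^ n * ∑ σ, ENNReal.ofReal (orthantIntegral μ f σ ^ 2) + ∫⁻ x, energy x ∂μ := by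
        rw [Finset.sum_add_distrib, ← Finset.mul_sum, ← lintegral_eq_sum_signFlip hac hpres energy,
          mul_add, ← mul_assoc, two_pow_mul_measure_posOrthant hac hpres, one_mul]

end Orthants

theorem theorem1p3_general {n : ℕ} {p : ℝ} (hp : 1 < p)
    (φ : (Fin n → ℝ) → EReal) (hφ_bot : ∀ x, φ x ≠ ⊥)
    (hφ_meas : AEMeasurable φ volume)
    (hφ_unc : Unconditional φ)
    (hφ_mono : MonotoneOn φ (posOrthant n))
    (hφ_conv : FracConvexOnOrthant (1 / p) φ)
    (μ : Measure (Fin n → ℝ)) [IsProbabilityMeasure μ]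
    (hμ : μ = volume.withDensity (fun x => EReal.exp (-φ x)))
    (f : (Fin n → ℝ) → ℝ) (hf_lip : LocallyLipschitz f)
    (hf_int : Integrable f μ) (hf_mean : ∫ x, f x ∂μ = 0) :
    (∫⁻ x, ENNReal.ofReal (f x ^ 2) ∂μ ≤
      ∫⁻ x, ∑ i, (ENNReal.ofReal (p ^ 2 / (p - 1) * x i ^ 2) + secondMoment μ i) *
        ENNReal.ofReal (|partialDeriv i f x| ^ 2) ∂μ) ∧
    (Unconditional f →
      ∫⁻ x, ENNReal.ofReal (f x ^ 2) ∂μ ≤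
        ∫⁻ x, ∑ i, ENNReal.ofReal (p ^ 2 / (p - 1) * x i ^ 2) *
          ENNReal.ofReal (|partialDeriv i f x| ^ 2) ∂μ) := by
  have hw : AEMeasurable (fun x => EReal.exp (-φ x)) volume :=
    EReal.measurable_exp.comp_aemeasurable hφ_meas.neg
  have hw_anti : AntitoneOn (fun x => EReal.exp (-φ x)) (posOrthant n) := fun x hx y hy hxy =>
    EReal.exp_monotone (EReal.neg_le_neg_iff.2 (hφ_mono hx hy hxy))
  have hw_unc : Unconditional fun x => EReal.exp (-φ x) :=
    fun x => congrArg (fun t => EReal.exp (-t)) (hφ_unc x)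
  have within := lintegral_sq_le_sum_orthantIntegral hp hw hw_unc
    (fun _ _ => hφ_conv.exp_neg_mul_le_sq hφ_bot) hμ hf_lip hf_int
  refine ⟨?_, fun hf_unc => ?_⟩
  · have between := two_pow_mul_sum_orthantIntegral_sq_le hw hw_unc hw_anti hμ hf_lip hf_int hf_mean
    have slope_measurable := fun i => measurable_partialDeriv hf_lip.continuous i
    simp only [add_mul, Finset.sum_add_distrib]
    rw [lintegral_add_left (by fun_prop), add_comm]
    exact within.trans (add_le_add_left between _)
  · have orthantIntegral_eq_zero := hf_unc.orthantIntegral_eq_zero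
      (hμ ▸ withDensity_absolutelyContinuous volume _) (hμ ▸ hw_unc.measurePreserving_signFlip)
      hf_int hf_mean
    simpa [orthantIntegral_eq_zero] using within

theorem theorem1p3 {n k : ℕ} (hk : 1 < k)
    (φ : (Fin n → ℝ) → EReal) (hφ_bot : ∀ x, φ x ≠ ⊥)
    (hφ_meas : AEMeasurable φ volume)
    (hφ_unc : Unconditional φ)
    (hφ_mono : MonotoneOn φ (posOrthant n))
    (hφ_conv : FracConvexOnOrthant (1 / (k : ℝ)) φ)
    (μ : Measure (Fin n → ℝ)) [IsProbabilityMeasure μ]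
    (hμ : μ = volume.withDensity (fun x => EReal.exp (-φ x)))
    (f : (Fin n → ℝ) → ℝ) (hf_lip : LocallyLipschitz f)
    (hf_int : Integrable f μ) (hf_mean : ∫ x, f x ∂μ = 0) :
    (∫⁻ x, ENNReal.ofReal (f x ^ 2) ∂μ ≤
      ∫⁻ x, ∑ i, (ENNReal.ofReal ((k : ℝ) ^ 2 / ((k : ℝ) - 1) * x i ^ 2) + secondMoment μ i) *
        ENNReal.ofReal (|partialDeriv i f x| ^ 2) ∂μ) ∧
    (Unconditional f →
      ∫⁻ x, ENNReal.ofReal (f x ^ 2) ∂μ ≤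
        ∫⁻ x, ∑ i, ENNReal.ofReal ((k : ℝ) ^ 2 / ((k : ℝ) - 1) * x i ^ 2) *
          ENNReal.ofReal (|partialDeriv i f x| ^ 2) ∂μ) := by
  exact theorem1p3_general (mod_cast hk) φ hφ_bot hφ_meas hφ_unc hφ_mono hφ_conv μ hμ f hf_lip
    hf_int hf_mean
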